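/- For $\tau$ in the upper half plane $\mathbb H$ put $q=e^{\pi i\tau}$ and $$\theta_2(0,q)=\sum_{n\in\mathbb Z}e^{\pi i\tau(n+1/2)^2},\qquad \theta_3(0,q)=\sum_{n\in\mathbb Z}q^{n^2},\qquad \theta_4(0,q)=\sum_{n\in\mathbb Z}(-1)^nq^{n^2}.$$ Let $$\varpi_0(\lambda)=\frac1\pi\int_1^\infty\frac{dx}{\sqrt{x(x-1)(x-\lambda)}}\quad(|\lambda|<1),\qquad \varpi_1(\lambda)=-\frac1{\pi i}\int_\lambda^1\frac{dx}{\sqrt{x(1-x)(x-\lambda)}}\quad(0<\lambda<1)$$ be the periods of the Legendre family $y^2=x(x-1)(x-\lambda)$ (with the principal square root of $x-\lambda$ in the first integral and positive roots in the second). **Lemma.** (i) $\varpi_0(\lambda)={}_2F_1(\tfrac12,\tfrac12;1;\lambda)$ for $|\lambda|<1$. (ii) There is exactly one holomorphic function $\lambda:\mathbb H\to\mathbb C\setminus\{0,1\}$ that inverts the period ratio, i.e. such that for all $s\in(0,1)$ the number $\varpi_1(s)/\varpi_0(s)$ lies in $\mathbb H$ and $\lambda(\varpi_1(s)/\varpi_0(s))=s$.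 It is the modular lambda function. (iii) There is exactly one holomorphic function on $\mathbb H$, written $\tau\mapsto\varpi_0(\lambda(q))$, that is the analytic continuation of $\varpi_0$ along $\lambda$ from the cusp: for $\operatorname{Im}\tau$ sufficiently large one has $|\lambda(\tau)|<1$ and its value at $\tau$ is $\varpi_0(\lambda(\tau))$, and near every $\tau_0\in\mathbb H$ it is of the form $g(\lambda(\tau))$ with $g$ holomorphic near $\lambda(\tau_0)$. (iv) For all $\tau\in\mathbb H$, $$\varpi_0(\lambda(q))=\theta_3^2(0,q),\qquad \theta_2^4(0,q)=\lambda\,\varpi_0^2(\lambda(q)),\qquad \theta_4^4(0,q)=(1-\lambda)\,\varpi_0^2(\lambda(q)).$$ -/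

import Mathlib

open scoped UpperHalfPlane Manifold Topology Real

noncomputable section

namespace LegendreFamily

/-- The holomorphic period `ϖ₀` of the Legendre family `y² = x (x - 1) (x - s)`,
`ϖ₀(s) = (1/π) ∫_1^∞ dx / √(x (x - 1) (x - s))`. For `s` off the cut `[1, ∞)` the square root is the
branch `√(x (x - 1)) · √(x - s)` with the principal square root of `x - s`, which is off the
negative real axis. -/
def period₀ (s : ℂ) : ℂ :=
  (1 / π : ℂ) * ∫ x in Set.Ioi (1 : ℝ), 1 / ((√(x * (x - 1)) : ℂ) * ((x : ℂ) - s) ^ (1 / 2 : ℂ))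

/-- The second period `ϖ₁(s) = - (1 / (π i)) ∫_s^1 dx / √(x (1 - x) (x - s))` of the Legendre
family, for `0 < s < 1`. -/
def period₁ (s : ℝ) : ℂ :=
  -(1 / (π * Complex.I)) * ((∫ x in s..1, 1 / √(x * (1 - x) * (x - s)) : ℝ) : ℂ)

/-- `lam` is the modular lambda function: the holomorphic function on the upper half plane, with
values in `ℂ ∖ {0, 1}`, that inverts the period ratio `s ↦ ϖ₁(s) / ϖ₀(s)`. (The periods are
multivalued; a holomorphic function on the upper half plane is determined by its values on the
curve of ratios for `0 < s < 1`, where the branches of the periods are fixed by the real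
integrals.) -/
structure IsModularLambda (lam : ℍ → ℂ) : Prop where
  holomorphic : MDifferentiable 𝓘(ℂ) 𝓘(ℂ) lam
  ne_zero : ∀ τ, lam τ ≠ 0
  ne_one : ∀ τ, lam τ ≠ 1
  inverts : ∀ s ∈ Set.Ioo (0 : ℝ) 1, ∃ τ : ℍ, (τ : ℂ) = period₁ s / period₀ s ∧ lam τ = s

/-- `W` is the composite `τ ↦ ϖ₀(lam τ)` on the upper half plane, where the multivalued function
`ϖ₀` on `ℂ ∖ {0, 1}` is continued analytically along `lam`, starting from its principal branch on
the unit disc for `τ` near `i∞`. -/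
structure IsPeriodAlong (lam W : ℍ → ℂ) : Prop where
  holomorphic : MDifferentiable 𝓘(ℂ) 𝓘(ℂ) W
  near_cusp : ∀ᶠ τ in UpperHalfPlane.atImInfty, ‖lam τ‖ < 1 ∧ W τ = period₀ (lam τ)
  /-- Locally `W` is a holomorphic branch evaluated at `lam`. -/
  branch : ∀ τ₀ : ℍ, ∃ g : ℂ → ℂ, AnalyticAt ℂ g (lam τ₀) ∧ ∀ᶠ τ in 𝓝 τ₀, W τ = g (lam τ)

/-- `θ₂(0, q) = ∑ q ^ ((n + 1/2)²)` with `q = exp (π i τ)`. -/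
def theta₂ (τ : ℍ) : ℂ := ∑' n : ℤ, Complex.exp (π * Complex.I * τ * ((n : ℂ) + 1 / 2) ^ 2)

/-- `θ₃(0, q) = ∑ q ^ (n²)` with `q = exp (π i τ)`. -/
def theta₃ (τ : ℍ) : ℂ := ∑' n : ℤ, Complex.exp (π * Complex.I * τ * (n : ℂ) ^ 2)

/-- `θ₄(0, q) = ∑ (-1) ^ n q ^ (n²)` with `q = exp (π i τ)`. -/
def theta₄ (τ : ℍ) : ℂ :=
  ∑' n : ℤ, (-1 : ℂ) ^ n * Complex.exp (π * Complex.I * τ * (n : ℂ) ^ 2)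

end LegendreFamily

end

noncomputable section

namespace LegendreFamily

open Complex Filter Set MeasureTheory

/-! ### Theta constants on `ℂ` -/

/-! The bridge between theta constants and periods is the arithmetic-geometric mean. Put `λ = 1 -
θ₄⁴/θ₃⁴`. Replacing τ by 2τ performs one AGM step on the pair (θ₃², θ₄²)
(`thetaThree_sq_add_thetaFour_sq`, `thetaThree_mul_thetaFour`), and the symmetric elliptic integral
I(a, b) is invariant under such a step (`ellipticI_gauss`). On the imaginary axis, iterating towards
the cusp gives I(θ₃², θ₄²) = I(1, 1) = π/2, which by homogeneity says ϖ₀(λ) = θ₃²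
(`period₀_lambdaReal`).

Since ϖ₁(s) = i ϖ₀(1 - s) and τ ↦ -1/τ exchanges λ and 1 - λ, the period ratio at λ(it) is it. As
λ(it) sweeps out (0, 1), λ inverts the ratio. Any other inverse, and likewise any other continuation
of ϖ₀, agrees with the given one high on the imaginary axis, hence everywhere by the identity
theorem.

That θ₃² is locally a holomorphic function of λ requires λ' ≠ 0. Constancy of the Wronskian of ϖ₀(s)
and ϖ₀(1 - s) makes λ(1 - λ)θ₃⁴ a constant multiple of λ', and the theta constants have no zeros
(`deriv_lambdaFun_ne_zero`).

The hypergeometric series comes from expanding the integrand binomially and integrating termwise.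
With W = θ₃² identified, the remaining identities are λ = θ₂⁴/θ₃⁴ (Jacobi) and 1 - λ = θ₄⁴/θ₃⁴. -/

/-- The general term `exp (π i τ x²)` of the theta series. -/
def thetaTerm (τ : ℂ) (x : ℂ) : ℂ := cexp (π * I * τ * x ^ 2)

/-- `θ₂` as a function on `ℂ`. -/
def thetaTwo (τ : ℂ) : ℂ := ∑' n : ℤ, thetaTerm τ (n + 1 / 2)

/-- `θ₃` as a function on `ℂ`. -/
def thetaThree (τ : ℂ) : ℂ := ∑' n : ℤ, thetaTerm τ n

/-- `θ₄` as a function on `ℂ`. -/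
def thetaFour (τ : ℂ) : ℂ := ∑' n : ℤ, (-1 : ℂ) ^ n * thetaTerm τ n

lemma theta₂_eq (τ : ℍ) : theta₂ τ = thetaTwo τ := rfl

lemma theta₃_eq (τ : ℍ) : theta₃ τ = thetaThree τ := rfl

lemma theta₄_eq (τ : ℍ) : theta₄ τ = thetaFour τ := rfl

lemma exp_pi_mul_I_mul_int (n : ℤ) : cexp (π * I * n) = (-1 : ℂ) ^ n := by
  rw [← exp_pi_mul_I, ← Complex.exp_int_mul, mul_comm]

lemma neg_one_zpow_mul_self (n : ℤ) : (-1 : ℂ) ^ n * (-1 : ℂ) ^ n = 1 := by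
  rw [← mul_zpow]; norm_num

lemma neg_one_zpow_add (a b : ℤ) : (-1 : ℂ) ^ (a + b) = (-1 : ℂ) ^ a * (-1 : ℂ) ^ b :=
  zpow_add₀ (by norm_num) a b

lemma neg_one_zpow_sub (a b : ℤ) : (-1 : ℂ) ^ (a - b) = (-1 : ℂ) ^ a * (-1 : ℂ) ^ b := by
  rw [zpow_sub₀ (by norm_num), div_eq_mul_inv, inv_eq_of_mul_eq_one_left (neg_one_zpow_mul_self b)]

lemma thetaTerm_int_eq (τ : ℂ) (n : ℤ) : thetaTerm τ n = jacobiTheta₂_term n 0 τ := by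
  simp only [thetaTerm, jacobiTheta₂_term]; congr 1; ring

lemma neg_one_zpow_mul_thetaTerm_eq (τ : ℂ) (n : ℤ) :
    (-1 : ℂ) ^ n * thetaTerm τ n = jacobiTheta₂_term n (1 / 2) τ := by
  simp only [thetaTerm, jacobiTheta₂_term]
  rw [← exp_pi_mul_I_mul_int, ← Complex.exp_add]; congr 1; ring

lemma thetaTerm_half_eq (τ : ℂ) (n : ℤ) :
    thetaTerm τ (n + 1 / 2) = cexp (π * I * τ / 4) * jacobiTheta₂_term n (τ / 2) τ := by
  simp only [thetaTerm, jacobiTheta₂_term]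
  rw [← Complex.exp_add]; congr 1; ring

lemma thetaTwo_eq_jacobi (τ : ℂ) :
    thetaTwo τ = cexp (π * I * τ / 4) * jacobiTheta₂ (τ / 2) τ := by
  simp only [thetaTwo, jacobiTheta₂, thetaTerm_half_eq, tsum_mul_left]

lemma thetaThree_eq_jacobi (τ : ℂ) : thetaThree τ = jacobiTheta₂ 0 τ := by
  simp only [thetaThree, jacobiTheta₂, thetaTerm_int_eq]

lemma thetaFour_eq_jacobi (τ : ℂ) : thetaFour τ = jacobiTheta₂ (1 / 2) τ := by
  simp only [thetaFour, jacobiTheta₂, neg_one_zpow_mul_thetaTerm_eq]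

lemma summable_thetaTerm_int {τ : ℂ} (hτ : 0 < τ.im) :
    Summable fun n : ℤ => thetaTerm τ n := by
  simpa only [thetaTerm_int_eq] using (summable_jacobiTheta₂_term_iff 0 τ).2 hτ

lemma summable_neg_one_zpow_mul_thetaTerm {τ : ℂ} (hτ : 0 < τ.im) :
    Summable fun n : ℤ => (-1 : ℂ) ^ n * thetaTerm τ n := by
  simpa only [neg_one_zpow_mul_thetaTerm_eq] using (summable_jacobiTheta₂_term_iff (1 / 2) τ).2 hτ

lemma summable_thetaTerm_half {τ : ℂ} (hτ : 0 < τ.im) :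
    Summable fun n : ℤ => thetaTerm τ (n + 1 / 2) := by
  simpa only [thetaTerm_half_eq] using
    ((summable_jacobiTheta₂_term_iff (τ / 2) τ).2 hτ).mul_left (cexp (π * I * τ / 4))

/-- Splitting of a double sum over `ℤ × ℤ` according to the parity of the sum of the indices. -/
lemma tsum_mul_tsum_of_parity {f g u v u' v' : ℤ → ℂ} (hf : Summable f) (hg : Summable g)
    (hu : Summable u) (hv : Summable v) (hu' : Summable u') (hv' : Summable v')
    (h : ∀ a b, f (a + b) * g (a - b) = u a * v b)
    (h' : ∀ a b, f (a + b + 1) * g (a - b) = u' a * v' b) :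
    (∑' n, f n) * (∑' n, g n) = (∑' n, u n) * (∑' n, v n) + (∑' n, u' n) * (∑' n, v' n) := by
  let e : (ℤ × ℤ) ⊕ (ℤ × ℤ) → ℤ × ℤ :=
    Sum.elim (fun p => (p.1 + p.2, p.1 - p.2)) (fun p => (p.1 + p.2 + 1, p.1 - p.2))
  have he : Function.Bijective e := by
    constructor
    · rintro (⟨a, b⟩ | ⟨a, b⟩) (⟨c, d⟩ | ⟨c, d⟩) H <;>
        simp only [e, Sum.elim_inl, Sum.elim_inr, Prod.mk.injEq] at H
      · congr 2 <;> omega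
      · omega
      · omega
      · congr 2 <;> omega
    · rintro ⟨m, n⟩
      rcases Int.even_or_odd (m + n) with ⟨k, hk⟩ | ⟨k, hk⟩
      · exact ⟨Sum.inl (k, m - k), by simp [e]; omega⟩
      · exact ⟨Sum.inr (k, m - k - 1), by simp [e]; omega⟩
  have H1 : ∀ {f g : ℤ → ℂ}, Summable f → Summable g →
      HasSum (fun p : ℤ × ℤ => f p.1 * g p.2) ((∑' n, f n) * (∑' n, g n)) := fun hf hg =>
    hf.hasSum.mul hg.hasSum (summable_mul_of_summable_norm hf.norm hg.norm)
  have H2 := (Equiv.ofBijective e he).hasSum_iff.2 (H1 hf hg)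
  refine H2.unique (HasSum.sum ?_ ?_)
  · convert H1 hu hv using 2 with p
    exact h p.1 p.2
  · convert H1 hu' hv' using 2 with p
    exact h' p.1 p.2

/-- The parallelogram law, used with x = z + w and y = z - w, is what doubles τ. -/
lemma thetaTerm_mul_eq (τ : ℂ) {x y z w : ℂ} (h : x ^ 2 + y ^ 2 = 2 * (z ^ 2 + w ^ 2)) :
    thetaTerm τ x * thetaTerm τ y = thetaTerm (2 * τ) z * thetaTerm (2 * τ) w := by
  simp only [thetaTerm, ← Complex.exp_add]; congr 1
  linear_combination (π * I * τ) * h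

lemma im_two_mul_pos {τ : ℂ} (hτ : 0 < τ.im) : 0 < (2 * τ).im := by simpa using hτ

lemma thetaThree_sq {τ : ℂ} (hτ : 0 < τ.im) :
    thetaThree τ ^ 2 = thetaThree (2 * τ) ^ 2 + thetaTwo (2 * τ) ^ 2 := by
  have h2 := im_two_mul_pos hτ
  simp only [sq]
  refine tsum_mul_tsum_of_parity (summable_thetaTerm_int hτ) (summable_thetaTerm_int hτ)
    (summable_thetaTerm_int h2) (summable_thetaTerm_int h2) (summable_thetaTerm_half h2)
    (summable_thetaTerm_half h2) (fun a b => thetaTerm_mul_eq τ ?_) fun a b => thetaTerm_mul_eq τ ?_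
  all_goals push_cast; ring

/-- The product of signs is +1 when the index sum is even and -1 when it is odd, so the odd class
enters with a minus. -/
lemma thetaFour_sq {τ : ℂ} (hτ : 0 < τ.im) :
    thetaFour τ ^ 2 = thetaThree (2 * τ) ^ 2 - thetaTwo (2 * τ) ^ 2 := by
  have h2 := im_two_mul_pos hτ
  have := tsum_mul_tsum_of_parity (summable_neg_one_zpow_mul_thetaTerm hτ)
    (summable_neg_one_zpow_mul_thetaTerm hτ)
    (summable_thetaTerm_int h2) (summable_thetaTerm_int h2) (summable_thetaTerm_half h2).neg
    (summable_thetaTerm_half h2) (fun a b => ?_) fun a b => ?_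
  · rw [tsum_neg] at this
    simp only [sq]
    exact this.trans (by rw [thetaThree, thetaTwo]; ring)
  · rw [← thetaTerm_mul_eq τ (x := ((a + b : ℤ) : ℂ)) (y := ((a - b : ℤ) : ℂ))
      (by push_cast; ring), neg_one_zpow_add, neg_one_zpow_sub]
    linear_combination (thetaTerm τ (a + b : ℤ) * thetaTerm τ (a - b : ℤ)) *
      ((-1 : ℂ) ^ b * (-1 : ℂ) ^ b * neg_one_zpow_mul_self a + neg_one_zpow_mul_self b)
  · rw [neg_mul, ← thetaTerm_mul_eq τ (x := ((a + b + 1 : ℤ) : ℂ)) (y := ((a - b : ℤ) : ℂ))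
      (by push_cast; ring), neg_one_zpow_add, neg_one_zpow_add, neg_one_zpow_sub, zpow_one]
    linear_combination -(thetaTerm τ (a + b + 1 : ℤ) * thetaTerm τ (a - b : ℤ)) *
      ((-1 : ℂ) ^ b * (-1 : ℂ) ^ b * neg_one_zpow_mul_self a + neg_one_zpow_mul_self b)

lemma summable_neg_one_zpow_mul_thetaTerm_half {τ : ℂ} (hτ : 0 < τ.im) :
    Summable fun n : ℤ => (-1 : ℂ) ^ n * thetaTerm τ (n + 1 / 2) :=
  .of_norm (by simpa using (summable_thetaTerm_half hτ).norm)

/-- The reflection n ↦ -1 - n preserves (n + 1/2)² and reverses the sign. -/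
lemma tsum_neg_one_zpow_mul_thetaTerm_half (τ : ℂ) :
    ∑' n : ℤ, (-1 : ℂ) ^ n * thetaTerm τ (n + 1 / 2) = 0 := by
  have := (Equiv.subLeft (-1 : ℤ)).tsum_eq fun n : ℤ => (-1 : ℂ) ^ n * thetaTerm τ (n + 1 / 2)
  rw [← self_eq_neg, ← tsum_neg, ← this]
  refine tsum_congr fun n => ?_
  simp only [Equiv.subLeft_apply, neg_one_zpow_sub, zpow_neg, zpow_one, thetaTerm]
  push_cast
  ring_nf

/-- The geometric-mean half of the AGM step. The odd class contributes an alternating half-integer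
sum, which vanishes. -/
lemma thetaThree_mul_thetaFour {τ : ℂ} (hτ : 0 < τ.im) :
    thetaThree τ * thetaFour τ = thetaFour (2 * τ) ^ 2 := by
  have h2 := im_two_mul_pos hτ
  have := tsum_mul_tsum_of_parity (summable_thetaTerm_int hτ)
    (summable_neg_one_zpow_mul_thetaTerm hτ)
    (summable_neg_one_zpow_mul_thetaTerm h2) (summable_neg_one_zpow_mul_thetaTerm h2)
    (summable_neg_one_zpow_mul_thetaTerm_half h2)
    (summable_neg_one_zpow_mul_thetaTerm_half h2) (fun a b => ?_) fun a b => ?_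
  · rw [tsum_neg_one_zpow_mul_thetaTerm_half, mul_zero, add_zero] at this
    rw [sq]
    exact this
  · rw [mul_mul_mul_comm, ← thetaTerm_mul_eq τ (x := ((a + b : ℤ) : ℂ)) (y := ((a - b : ℤ) : ℂ))
      (by push_cast; ring), neg_one_zpow_sub]
    ring
  · rw [mul_mul_mul_comm, ← thetaTerm_mul_eq τ (x := ((a + b + 1 : ℤ) : ℂ))
      (y := ((a - b : ℤ) : ℂ)) (by push_cast; ring), neg_one_zpow_sub]
    ring

/-- Both parity classes give the same mixed product, after a unit shift of one index in the odd
class; hence the factor 2. -/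
lemma thetaTwo_sq {τ : ℂ} (hτ : 0 < τ.im) :
    thetaTwo τ ^ 2 = 2 * thetaTwo (2 * τ) * thetaThree (2 * τ) := by
  have h2 := im_two_mul_pos hτ
  have hs : Summable fun n : ℤ => thetaTerm (2 * τ) (n + 1 : ℤ) :=
    (Equiv.addRight (1 : ℤ)).summable_iff.2 (summable_thetaTerm_int h2)
  have he : ∑' n : ℤ, thetaTerm (2 * τ) (n + 1 : ℤ) = thetaThree (2 * τ) :=
    (Equiv.addRight (1 : ℤ)).tsum_eq fun n : ℤ => thetaTerm (2 * τ) n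
  have := tsum_mul_tsum_of_parity (summable_thetaTerm_half hτ) (summable_thetaTerm_half hτ)
    (summable_thetaTerm_half h2) (summable_thetaTerm_int h2) hs
    (summable_thetaTerm_half h2) (fun a b => thetaTerm_mul_eq τ ?_) fun a b => thetaTerm_mul_eq τ ?_
  · rw [he] at this
    rw [sq]
    exact this.trans (by rw [thetaThree, thetaTwo]; ring)
  all_goals push_cast; ring

/-- Jacobi's identity. -/
lemma thetaThree_pow_four {τ : ℂ} (hτ : 0 < τ.im) :
    thetaThree τ ^ 4 = thetaTwo τ ^ 4 + thetaFour τ ^ 4 := by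
  have e3 := thetaThree_sq hτ
  have e4 := thetaFour_sq hτ
  have e2 := thetaTwo_sq hτ
  rw [show thetaThree τ ^ 4 = (thetaThree τ ^ 2) ^ 2 by ring,
    show thetaTwo τ ^ 4 = (thetaTwo τ ^ 2) ^ 2 by ring,
    show thetaFour τ ^ 4 = (thetaFour τ ^ 2) ^ 2 by ring, e3, e4, e2]
  ring

/-- The arithmetic-mean half of the AGM step. -/
lemma thetaThree_sq_add_thetaFour_sq {τ : ℂ} (hτ : 0 < τ.im) :
    thetaThree τ ^ 2 + thetaFour τ ^ 2 = 2 * thetaThree (2 * τ) ^ 2 := by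
  rw [thetaThree_sq hτ, thetaFour_sq hτ]; ring

/-! ### Limits at `i∞`, non-vanishing and the transformation `τ ↦ -1/τ` -/

lemma thetaThree_eq_jacobiTheta (τ : ℂ) : thetaThree τ = jacobiTheta τ := by
  rw [thetaThree_eq_jacobi, jacobiTheta_eq_jacobiTheta₂]

lemma thetaFour_eq_jacobiTheta (τ : ℂ) : thetaFour τ = jacobiTheta (τ + 1) := by
  refine tsum_congr fun n => ?_
  rw [thetaTerm, ← exp_pi_mul_I_mul_int, ← Complex.exp_add, Complex.exp_eq_exp_iff_exists_int]
  -- n² - n is even, so the two exponents differ by a multiple of 2πi.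
  obtain ⟨k, hk⟩ := Int.even_mul_succ_self (n - 1)
  refine ⟨-k, ?_⟩
  have : ((n : ℂ) - 1) * (n - 1 + 1) = k + k := by exact_mod_cast hk
  push_cast
  linear_combination (-(π * I)) * this

lemma tendsto_jacobiTheta_comap_im : Tendsto jacobiTheta (comap im atTop) (𝓝 1) := by
  have h : Tendsto (fun τ : ℂ => rexp (-π * τ.im)) (comap im atTop) (𝓝 0) :=
    Real.tendsto_exp_atBot.comp
      ((tendsto_id.const_mul_atTop_of_neg (by linarith [Real.pi_pos])).comp tendsto_comap)
  have := isBigO_at_im_infty_jacobiTheta_sub_one.trans_tendsto h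
  simpa using this.add_const 1

lemma tendsto_thetaThree : Tendsto thetaThree (comap im atTop) (𝓝 1) := by
  simpa only [funext thetaThree_eq_jacobiTheta] using tendsto_jacobiTheta_comap_im

lemma tendsto_thetaFour : Tendsto thetaFour (comap im atTop) (𝓝 1) := by
  rw [funext thetaFour_eq_jacobiTheta]
  refine tendsto_jacobiTheta_comap_im.comp (tendsto_comap_iff.2 ?_)
  convert! (tendsto_comap : Tendsto im (comap im atTop) atTop) using 1
  ext τ
  simp

lemma tendsto_two_pow_mul {τ : ℂ} (hτ : 0 < τ.im) :
    Tendsto (fun n : ℕ => (2 : ℂ) ^ n * τ) atTop (comap im atTop) := by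
  refine tendsto_comap_iff.2 ?_
  have : (im ∘ fun n : ℕ => (2 : ℂ) ^ n * τ) = fun n : ℕ => (2 : ℝ) ^ n * τ.im := by
    ext n
    rw [Function.comp_apply, show ((2 : ℂ) ^ n) = ((2 ^ n : ℝ) : ℂ) by push_cast; rfl,
      Complex.im_ofReal_mul]
  rw [this]
  exact (tendsto_pow_atTop_atTop_of_one_lt (by norm_num)).atTop_mul_const hτ

lemma im_two_pow_mul_pos {τ : ℂ} (hτ : 0 < τ.im) (n : ℕ) : 0 < ((2 : ℂ) ^ n * τ).im := by
  rw [show ((2 : ℂ) ^ n) = ((2 ^ n : ℝ) : ℂ) by push_cast; rfl, Complex.im_ofReal_mul]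
  positivity

/-- By the product formula a zero at τ propagates to every 2ⁿτ, contradicting θ₄ → 1 at the cusp. -/
lemma thetaFour_ne_zero {τ : ℂ} (hτ : 0 < τ.im) : thetaFour τ ≠ 0 := by
  intro h
  have h0 : ∀ n : ℕ, thetaFour (2 ^ n * τ) = 0 := by
    intro n
    induction n with
    | zero => simpa using h
    | succ n ih =>
      have := thetaThree_mul_thetaFour (im_two_pow_mul_pos hτ n)
      rw [ih, mul_zero, ← mul_assoc, ← pow_succ'] at this
      exact pow_eq_zero_iff two_ne_zero |>.1 this.symm
  have := tendsto_thetaFour.comp (tendsto_two_pow_mul hτ)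
  simp only [Function.comp_def, h0] at this
  exact zero_ne_one (tendsto_nhds_unique tendsto_const_nhds this)

lemma thetaThree_ne_zero {τ : ℂ} (hτ : 0 < τ.im) : thetaThree τ ≠ 0 := by
  intro h
  have := thetaThree_mul_thetaFour hτ
  rw [h, zero_mul] at this
  exact thetaFour_ne_zero (im_two_mul_pos hτ) (pow_eq_zero_iff two_ne_zero |>.1 this.symm)

lemma im_neg_one_div_pos {τ : ℂ} (hτ : 0 < τ.im) : 0 < (-1 / τ).im := by
  have : τ ≠ 0 := by rintro rfl; simp at hτ
  rw [neg_div, neg_im, one_div, inv_im, neg_div, neg_neg]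
  exact div_pos hτ (normSq_pos.2 this)

lemma neg_I_mul_cpow_half_sq {τ : ℂ} : ((-I * τ) ^ (1 / 2 : ℂ)) ^ 2 = -I * τ := by
  rw [← Complex.cpow_nat_mul]; norm_num

lemma thetaThree_neg_one_div {τ : ℂ} (hτ : 0 < τ.im) :
    thetaThree (-1 / τ) = (-I * τ) ^ (1 / 2 : ℂ) * thetaThree τ := by
  have h0 : τ ≠ 0 := by rintro rfl; simp at hτ
  have h1 : (-I * τ) ^ (1 / 2 : ℂ) ≠ 0 := by simp [Complex.cpow_eq_zero_iff, h0]
  have := jacobiTheta₂_functional_equation 0 τ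
  rw [thetaThree_eq_jacobi, thetaThree_eq_jacobi, this]
  simp only [zero_div]
  field_simp
  simp

lemma thetaTwo_neg_one_div {τ : ℂ} (hτ : 0 < τ.im) :
    thetaTwo (-1 / τ) = (-I * τ) ^ (1 / 2 : ℂ) * thetaFour τ := by
  have h0 : τ ≠ 0 := by rintro rfl; simp at hτ
  have h1 : (-I * τ) ^ (1 / 2 : ℂ) ≠ 0 := by simp [Complex.cpow_eq_zero_iff, h0]
  have := jacobiTheta₂_functional_equation (1 / 2) τ
  rw [thetaTwo_eq_jacobi, thetaFour_eq_jacobi, this,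
    show -1 / τ / 2 = -(1 / 2 / τ) by field_simp, jacobiTheta₂_neg_left,
    show (π : ℂ) * I * (-1 / τ) / 4 = -π * I * (1 / 2) ^ 2 / τ by field_simp; norm_num]
  field_simp

lemma thetaTwo_ne_zero {τ : ℂ} (hτ : 0 < τ.im) : thetaTwo τ ≠ 0 := by
  have h0 : τ ≠ 0 := by rintro rfl; simp at hτ
  have := thetaTwo_neg_one_div (im_neg_one_div_pos hτ)
  rw [show -1 / (-1 / τ) = τ by field_simp] at this
  rw [this]
  refine mul_ne_zero ?_ (thetaFour_ne_zero (im_neg_one_div_pos hτ))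
  simp [Complex.cpow_eq_zero_iff, h0]

lemma differentiableAt_thetaThree {τ : ℂ} (hτ : 0 < τ.im) : DifferentiableAt ℂ thetaThree τ := by
  rw [funext thetaThree_eq_jacobi]
  exact differentiableAt_jacobiTheta₂_snd 0 hτ

lemma differentiableAt_thetaFour {τ : ℂ} (hτ : 0 < τ.im) : DifferentiableAt ℂ thetaFour τ := by
  rw [funext thetaFour_eq_jacobi]
  exact differentiableAt_jacobiTheta₂_snd _ hτ

/-! ### The modular lambda function -/

/-- The modular lambda function `θ₂⁴ / θ₃⁴ = 1 - θ₄⁴ / θ₃⁴`. -/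
def lambdaFun (τ : ℂ) : ℂ := 1 - thetaFour τ ^ 4 / thetaThree τ ^ 4

lemma one_sub_lambdaFun (τ : ℂ) : 1 - lambdaFun τ = thetaFour τ ^ 4 / thetaThree τ ^ 4 := by
  rw [lambdaFun]; ring

/-- Jacobi's identity. Defining λ through θ₄ leaves only θ₃ and θ₄ to be studied for holomorphy and
limits. -/
lemma lambdaFun_eq {τ : ℂ} (hτ : 0 < τ.im) : lambdaFun τ = thetaTwo τ ^ 4 / thetaThree τ ^ 4 := by
  have h := thetaThree_ne_zero hτ
  rw [lambdaFun]
  field_simp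
  linear_combination thetaThree_pow_four hτ

lemma lambdaFun_ne_zero {τ : ℂ} (hτ : 0 < τ.im) : lambdaFun τ ≠ 0 := by
  rw [lambdaFun_eq hτ]
  exact div_ne_zero (pow_ne_zero _ (thetaTwo_ne_zero hτ)) (pow_ne_zero _ (thetaThree_ne_zero hτ))

lemma one_sub_lambdaFun_ne_zero {τ : ℂ} (hτ : 0 < τ.im) : 1 - lambdaFun τ ≠ 0 := by
  rw [one_sub_lambdaFun]
  exact div_ne_zero (pow_ne_zero _ (thetaFour_ne_zero hτ)) (pow_ne_zero _ (thetaThree_ne_zero hτ))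

/-- Inversion turns θ₂ into θ₄ and fixes θ₃, with a common automorphy factor that cancels in the
quotient. -/
lemma lambdaFun_neg_one_div {τ : ℂ} (hτ : 0 < τ.im) : lambdaFun (-1 / τ) = 1 - lambdaFun τ := by
  have h0 : τ ≠ 0 := by rintro rfl; simp at hτ
  have h1 : (-I * τ) ^ (1 / 2 : ℂ) ≠ 0 := by simp [Complex.cpow_eq_zero_iff, h0]
  have h3 := thetaThree_ne_zero hτ
  rw [one_sub_lambdaFun, lambdaFun_eq (im_neg_one_div_pos hτ), thetaTwo_neg_one_div hτ,
    thetaThree_neg_one_div hτ]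
  field_simp

lemma differentiableAt_lambdaFun {τ : ℂ} (hτ : 0 < τ.im) : DifferentiableAt ℂ lambdaFun τ :=
  (((differentiableAt_thetaFour hτ).pow 4).div ((differentiableAt_thetaThree hτ).pow 4)
    (pow_ne_zero _ (thetaThree_ne_zero hτ))).const_sub 1

lemma tendsto_lambdaFun : Tendsto lambdaFun (comap im atTop) (𝓝 0) := by
  have := ((tendsto_thetaFour.pow 4).div (tendsto_thetaThree.pow 4) (by norm_num)).const_sub 1
  simpa using! this

/-! ### The symmetric elliptic integral and Gauss's transformation -/

/-- The symmetric complete elliptic integral `∫₀^∞ dt / √((t² + a²) (t² + b²))`. -/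
def ellipticI (a b : ℝ) : ℝ := ∫ t in Ioi (0 : ℝ), 1 / √((t ^ 2 + a ^ 2) * (t ^ 2 + b ^ 2))

lemma inv_sq_add_sq_eq {a : ℝ} (ha : 0 < a) (t : ℝ) :
    (t ^ 2 + a ^ 2)⁻¹ = (a ^ 2)⁻¹ * (1 + (a⁻¹ * t) ^ 2)⁻¹ := by
  field_simp
  ring

lemma integrable_inv_sq_add_sq {a : ℝ} (ha : 0 < a) : Integrable fun t : ℝ => (t ^ 2 + a ^ 2)⁻¹ := by
  simp only [inv_sq_add_sq_eq ha]
  exact (integrable_inv_one_add_sq.comp_mul_left' (inv_ne_zero ha.ne')).const_mul _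

lemma integral_Ioi_inv_sq_add_sq {a : ℝ} (ha : 0 < a) :
    ∫ t in Ioi (0 : ℝ), (t ^ 2 + a ^ 2)⁻¹ = π / 2 / a := by
  simp only [inv_sq_add_sq_eq ha]
  rw [integral_const_mul, integral_comp_mul_left_Ioi (fun x => (1 + x ^ 2)⁻¹) 0 (inv_pos.2 ha)]
  simp
  field_simp

lemma one_div_sqrt_mul_le {x y : ℝ} (hx : 0 < x) (hy : 0 < y) :
    1 / √(x * y) ≤ 1 / 2 * (x⁻¹ + y⁻¹) := by
  rw [Real.sqrt_mul hx.le, one_div, mul_inv]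
  have h1 : (√x)⁻¹ ^ 2 = x⁻¹ := by rw [inv_pow, Real.sq_sqrt hx.le]
  have h2 : (√y)⁻¹ ^ 2 = y⁻¹ := by rw [inv_pow, Real.sq_sqrt hy.le]
  rw [← h1, ← h2]
  linarith [sq_nonneg ((√x)⁻¹ - (√y)⁻¹)]

lemma le_one_div_sqrt_mul {x y : ℝ} (hx : 0 < x) (hy : 0 < y) :
    ((x + y) / 2)⁻¹ ≤ 1 / √(x * y) := by
  rw [one_div]
  refine inv_anti₀ (by positivity) ?_
  rw [Real.sqrt_le_left (by positivity)]
  linarith [sq_nonneg (x - y)]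

lemma integrable_ellipticI_integrand {a b : ℝ} (ha : 0 < a) (hb : 0 < b) :
    Integrable fun t : ℝ => 1 / √((t ^ 2 + a ^ 2) * (t ^ 2 + b ^ 2)) := by
  refine (((integrable_inv_sq_add_sq ha).add (integrable_inv_sq_add_sq hb)).const_mul
    (1 / 2)).mono' ?_ (.of_forall fun t => ?_)
  · have : Continuous fun t : ℝ => 1 / √((t ^ 2 + a ^ 2) * (t ^ 2 + b ^ 2)) :=
      continuous_const.div (by fun_prop) fun t => by positivity
    exact this.aestronglyMeasurable
  · rw [Real.norm_of_nonneg (by positivity)]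
    exact one_div_sqrt_mul_le (by positivity) (by positivity)

lemma ellipticI_le {a b : ℝ} (ha : 0 < a) (hb : 0 < b) :
    ellipticI a b ≤ 1 / 2 * (π / 2 / a + π / 2 / b) := by
  have hA := (integrable_inv_sq_add_sq ha).integrableOn (s := Ioi 0)
  have hB := (integrable_inv_sq_add_sq hb).integrableOn (s := Ioi 0)
  rw [← integral_Ioi_inv_sq_add_sq ha, ← integral_Ioi_inv_sq_add_sq hb, ← integral_add hA hB,
    ← integral_const_mul]
  exact integral_mono (integrable_ellipticI_integrand ha hb).integrableOn
    ((hA.add hB).const_mul _) fun t => one_div_sqrt_mul_le (by positivity) (by positivity)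

lemma le_ellipticI {a b : ℝ} (ha : 0 < a) (hb : 0 < b) :
    π / 2 / √((a ^ 2 + b ^ 2) / 2) ≤ ellipticI a b := by
  have hc : 0 < √((a ^ 2 + b ^ 2) / 2) := by positivity
  rw [← integral_Ioi_inv_sq_add_sq hc]
  refine integral_mono (integrable_inv_sq_add_sq hc).integrableOn
    (integrable_ellipticI_integrand ha hb).integrableOn fun t => ?_
  have := le_one_div_sqrt_mul (x := t ^ 2 + a ^ 2) (y := t ^ 2 + b ^ 2)
    (by positivity) (by positivity)
  simp only [Real.sq_sqrt (show 0 ≤ (a ^ 2 + b ^ 2) / 2 by positivity)]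
  refine le_trans (le_of_eq ?_) this
  congr 1
  ring

/-- A squeeze: the mean inequalities bound the integrand on both sides by functions of the form
1/(t² + c²), whose integrals are explicit. -/
lemma tendsto_ellipticI {a b : ℕ → ℝ} (ha : ∀ n, 0 < a n) (hb : ∀ n, 0 < b n)
    (ha' : Tendsto a atTop (𝓝 1)) (hb' : Tendsto b atTop (𝓝 1)) :
    Tendsto (fun n => ellipticI (a n) (b n)) atTop (𝓝 (π / 2)) := by
  refine tendsto_of_tendsto_of_tendsto_of_le_of_le ?_ ?_
    (fun n => le_ellipticI (ha n) (hb n)) fun n => ellipticI_le (ha n) (hb n)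
  · have := (tendsto_const_nhds (x := π / 2)).div
      ((((ha'.pow 2).add (hb'.pow 2)).div_const 2).sqrt) (by norm_num)
    simpa using! this
  · have h := tendsto_const_nhds (x := π / 2) (f := (atTop : Filter ℕ))
    have := ((h.div ha' one_ne_zero).add (h.div hb' one_ne_zero)).const_mul (1 / 2)
    convert! this using 2
    ring

lemma ellipticI_eq_mul {a b : ℝ} (ha : 0 < a) : ellipticI 1 (b / a) = a * ellipticI a b := by
  have h := integral_comp_mul_left_Ioi'
    (fun t : ℝ => 1 / √((t ^ 2 + a ^ 2) * (t ^ 2 + b ^ 2))) 0 ha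
  rw [mul_zero] at h
  rw [ellipticI, ellipticI, ← h, smul_eq_mul, ← mul_assoc, ← integral_const_mul]
  refine integral_congr_ae (.of_forall fun t => ?_)
  have : ((a * t) ^ 2 + a ^ 2) * ((a * t) ^ 2 + b ^ 2) =
      (a * a) ^ 2 * ((t ^ 2 + 1 ^ 2) * (t ^ 2 + (b / a) ^ 2)) := by
    field_simp
  simp only [this]
  rw [Real.sqrt_mul (by positivity) ((t ^ 2 + 1 ^ 2) * (t ^ 2 + (b / a) ^ 2)),
    Real.sqrt_sq (by positivity)]
  field_simp

lemma integral_ellipticI_integrand (a b : ℝ) :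
    ∫ t : ℝ, 1 / √((t ^ 2 + a ^ 2) * (t ^ 2 + b ^ 2)) = 2 * ellipticI a b := by
  have := integral_comp_abs (f := fun t : ℝ => 1 / √((t ^ 2 + a ^ 2) * (t ^ 2 + b ^ 2)))
  simpa only [sq_abs, ellipticI] using this

/-- Gauss's transformation. -/
lemma ellipticI_gauss {a b : ℝ} (ha : 0 < a) (hb : 0 < b) :
    ellipticI ((a + b) / 2) (√(a * b)) = ellipticI a b := by
  have hab : 0 < a * b := mul_pos ha hb
  -- φ maps (0, ∞) bijectively onto ℝ, so the left side becomes an integral over the whole line,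
  -- twice `ellipticI` by evenness.
  let φ : ℝ → ℝ := fun t => (t - a * b / t) / 2
  let φ' : ℝ → ℝ := fun t => (1 + a * b / t ^ 2) / 2
  have hφ : ∀ t ∈ Ioi (0 : ℝ), HasDerivWithinAt φ (φ' t) (Ioi 0) t := by
    intro t ht
    have ht0 : t ≠ 0 := (mem_Ioi.1 ht).ne'
    refine HasDerivAt.hasDerivWithinAt ?_
    have := ((hasDerivAt_id t).sub ((hasDerivAt_const t (a * b)).div (hasDerivAt_id t) ht0)).div_const 2
    convert! this using 1
    simp [φ']
    ring
  have hinj : InjOn φ (Ioi 0) := by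
    intro x hx y hy h
    have hx : 0 < x := hx
    have hy : 0 < y := hy
    simp only [φ] at h
    field_simp at h
    have : (x - y) * (x * y + a * b) = 0 := by linarith
    rcases mul_eq_zero.1 this with h | h
    · linarith
    · nlinarith [mul_pos hx hy]
  have himg : φ '' Ioi 0 = univ := by
    -- The positive root of t² - 2ut - ab = 0.
    refine eq_univ_of_forall fun u => ⟨u + √(u ^ 2 + a * b), ?_, ?_⟩
    · have : |u| < √(u ^ 2 + a * b) := by
        rw [Real.lt_sqrt (abs_nonneg u), sq_abs]; linarith
      have := neg_abs_le u
      simp only [mem_Ioi]; linarith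
    · have : |u| < √(u ^ 2 + a * b) := by
        rw [Real.lt_sqrt (abs_nonneg u), sq_abs]; linarith
      have h1 := neg_abs_le u
      have h2 := Real.sq_sqrt (show 0 ≤ u ^ 2 + a * b by positivity)
      have h3 : u + √(u ^ 2 + a * b) ≠ 0 := by linarith
      simp only [φ]
      field_simp
      linarith
  have key := integral_image_eq_integral_abs_deriv_smul measurableSet_Ioi hφ hinj
    (fun u => 1 / √((u ^ 2 + ((a + b) / 2) ^ 2) * (u ^ 2 + √(a * b) ^ 2)))
  rw [himg, setIntegral_univ, integral_ellipticI_integrand] at key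
  have h2 : ∫ t in Ioi (0 : ℝ), |φ' t| •
      (1 / √((φ t ^ 2 + ((a + b) / 2) ^ 2) * (φ t ^ 2 + √(a * b) ^ 2))) = 2 * ellipticI a b := by
    rw [ellipticI, ← integral_const_mul]
    refine setIntegral_congr_fun measurableSet_Ioi fun t ht => ?_
    have ht : 0 < t := ht
    -- The first factor is (t² + a²)(t² + b²)/(4t²), the second the perfect square ((t² +
    -- ab)/(2t))².
    have e : (φ t ^ 2 + ((a + b) / 2) ^ 2) * (φ t ^ 2 + √(a * b) ^ 2) =
        ((t ^ 2 + a * b) / (4 * t ^ 2)) ^ 2 * ((t ^ 2 + a ^ 2) * (t ^ 2 + b ^ 2)) := by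
      rw [Real.sq_sqrt hab.le]
      simp only [φ]
      field_simp
      ring
    simp only [e]
    rw [Real.sqrt_mul (by positivity), Real.sqrt_sq (by positivity),
      abs_of_pos (by simp only [φ']; positivity), smul_eq_mul]
    simp only [φ']
    field_simp
    norm_num
  rw [h2] at key
  linarith

/-! ### The periods as symmetric elliptic integrals -/

/-- The substitution x = 1 + t² absorbs the singularity of √(x - 1) at x = 1. -/
lemma period₀_eq_integral (s : ℂ) :
    period₀ s = (2 / π : ℂ) * ∫ t in Ioi (0 : ℝ),
      1 / ((√(1 + t ^ 2) : ℂ) * ((1 + t ^ 2 : ℝ) - s) ^ (1 / 2 : ℂ)) := by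
  let φ : ℝ → ℝ := fun t => 1 + t ^ 2
  have hφ : ∀ t ∈ Ioi (0 : ℝ), HasDerivWithinAt φ (2 * t) (Ioi 0) t := fun t _ => by
    simpa [φ] using ((hasDerivAt_pow 2 t).const_add 1).hasDerivWithinAt
  have hinj : InjOn φ (Ioi 0) := fun x hx y hy h => by
    simp only [φ, add_right_inj] at h
    exact (pow_left_inj₀ (le_of_lt hx) (le_of_lt hy) two_ne_zero).1 h
  have himg : φ '' Ioi 0 = Ioi 1 := by
    ext x
    simp only [mem_image, mem_Ioi, φ]
    constructor
    · rintro ⟨t, ht, rfl⟩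
      have := pow_pos ht 2
      linarith
    · intro hx
      refine ⟨√(x - 1), Real.sqrt_pos.2 (by linarith), ?_⟩
      rw [Real.sq_sqrt (by linarith)]; ring
  have key := integral_image_eq_integral_abs_deriv_smul measurableSet_Ioi hφ hinj
    (fun x : ℝ => 1 / ((√(x * (x - 1)) : ℂ) * ((x : ℂ) - s) ^ (1 / 2 : ℂ)))
  rw [period₀, ← himg, key, show (2 / π : ℂ) = 1 / π * 2 by ring, mul_assoc, ← integral_const_mul (2 : ℂ)]
  congr 1
  refine setIntegral_congr_fun measurableSet_Ioi fun t ht => ?_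
  have ht : 0 < t := ht
  have e : (φ t) * (φ t - 1) = (1 + t ^ 2) * t ^ 2 := by simp only [φ]; ring
  have ht' : (t : ℂ) ≠ 0 := by exact_mod_cast ht.ne'
  simp only [e]
  rw [Real.sqrt_mul (by positivity), Real.sqrt_sq ht.le, abs_of_pos (by positivity)]
  simp only [φ, Complex.real_smul]
  push_cast
  field_simp

lemma period₀_ofReal {s : ℝ} (hs : s < 1) :
    period₀ s = ((2 / π * ellipticI 1 (√(1 - s)) : ℝ) : ℂ) := by
  rw [period₀_eq_integral, ellipticI]
  push_cast
  congr 1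
  rw [← integral_complex_ofReal]
  refine setIntegral_congr_fun measurableSet_Ioi fun t ht => ?_
  have h0 : 0 < 1 + t ^ 2 - s := by nlinarith [sq_nonneg t]
  have : (1 + (t : ℂ) ^ 2 - s) ^ (1 / 2 : ℂ) = (√(1 + t ^ 2 - s) : ℂ) := by
    rw [Real.sqrt_eq_rpow, Complex.ofReal_cpow h0.le]; push_cast; rfl
  simp only [this]
  rw [Real.sq_sqrt (by linarith), one_pow, Real.sqrt_mul (by positivity), add_comm (t ^ 2) 1,
    show t ^ 2 + (1 - s) = 1 + t ^ 2 - s by ring]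
  push_cast
  rfl

lemma integral_period₁ {s : ℝ} (hs0 : 0 < s) (hs1 : s < 1) :
    ∫ x in s..1, 1 / √(x * (1 - x) * (x - s)) = 2 * ellipticI 1 (√s) := by
  have h1s : 0 < 1 - s := by linarith
  -- Solves t² = (x - s)/(1 - x), sending (0, ∞) onto (s, 1).
  let φ : ℝ → ℝ := fun t => (s + t ^ 2) / (1 + t ^ 2)
  let φ' : ℝ → ℝ := fun t => 2 * t * (1 - s) / (1 + t ^ 2) ^ 2
  have hφ : ∀ t ∈ Ioi (0 : ℝ), HasDerivWithinAt φ (φ' t) (Ioi 0) t := fun t _ => by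
    have := ((hasDerivAt_pow 2 t).const_add s).div ((hasDerivAt_pow 2 t).const_add 1)
      (by positivity)
    convert! this.hasDerivWithinAt using 1
    simp [φ']
    ring
  have hinj : InjOn φ (Ioi 0) := fun x hx y hy h => by
    simp only [φ] at h
    rw [div_eq_div_iff (by positivity) (by positivity)] at h
    have : (1 - s) * (x ^ 2 - y ^ 2) = 0 := by linarith
    rcases mul_eq_zero.1 this with h | h
    · linarith
    · exact (pow_left_inj₀ (le_of_lt hx) (le_of_lt hy) two_ne_zero).1 (by linarith)
  have himg : φ '' Ioi 0 = Ioo s 1 := by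
    ext x
    simp only [mem_image, mem_Ioi, φ, mem_Ioo]
    constructor
    · rintro ⟨t, ht, rfl⟩
      have := pow_pos ht 2
      rw [lt_div_iff₀ (by positivity), div_lt_one (by positivity)]
      constructor <;> nlinarith
    · rintro ⟨hx, hx'⟩
      have h1 : 0 < x - s := by linarith
      have h2 : 0 < 1 - x := by linarith
      refine ⟨√((x - s) / (1 - x)), by positivity, ?_⟩
      rw [Real.sq_sqrt (by positivity)]
      field_simp
      ring
  rw [intervalIntegral.integral_of_le hs1.le, integral_Ioc_eq_integral_Ioo, ← himg,
    integral_image_eq_integral_abs_deriv_smul measurableSet_Ioi hφ hinj, ellipticI,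
    ← integral_const_mul]
  refine setIntegral_congr_fun measurableSet_Ioi fun t ht => ?_
  have ht : 0 < t := ht
  have e : φ t * (1 - φ t) * (φ t - s) = ((1 - s) * t / (1 + t ^ 2) ^ 2) ^ 2 *
      ((t ^ 2 + 1 ^ 2) * (t ^ 2 + √s ^ 2)) := by
    rw [Real.sq_sqrt hs0.le]
    simp only [φ]
    field_simp
    ring
  simp only [e]
  rw [Real.sqrt_mul (by positivity), Real.sqrt_sq (by positivity),
    abs_of_pos (by simp only [φ']; positivity), smul_eq_mul]
  simp only [φ']
  field_simp

lemma period₁_eq {s : ℝ} (hs0 : 0 < s) (hs1 : s < 1) :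
    period₁ s = I * period₀ ((1 - s : ℝ) : ℂ) := by
  rw [period₁, integral_period₁ hs0 hs1, period₀_ofReal (by linarith)]
  have : (π : ℂ) ≠ 0 := by exact_mod_cast Real.pi_ne_zero
  push_cast
  field_simp
  simp

lemma ellipticI_pos {a b : ℝ} (ha : 0 < a) (hb : 0 < b) : 0 < ellipticI a b :=
  lt_of_lt_of_le (by positivity) (le_ellipticI ha hb)

lemma period₀_ofReal_ne_zero {s : ℝ} (hs : s < 1) : period₀ s ≠ 0 := by
  rw [period₀_ofReal hs, Complex.ofReal_ne_zero]
  have := ellipticI_pos one_pos (Real.sqrt_pos.2 (sub_pos.2 hs))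
  positivity

/-! ### The periods on the imaginary axis -/

lemma im_ofReal_mul_I (t : ℝ) : ((t : ℂ) * I).im = t := by simp

lemma thetaTerm_ofReal_mul_I (t x : ℝ) :
    thetaTerm (t * I) x = (rexp (-(π * t * x ^ 2)) : ℝ) := by
  rw [thetaTerm]
  push_cast
  congr 1
  linear_combination (π * t * x ^ 2 : ℂ) * I_mul_I

lemma thetaThree_ofReal_mul_I (t : ℝ) :
    ((thetaThree (t * I)).re : ℂ) = thetaThree (t * I) := by
  have : thetaThree (t * I) = ((∑' n : ℤ, rexp (-(π * t * (n : ℝ) ^ 2)) : ℝ) : ℂ) := by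
    rw [Complex.ofReal_tsum]
    exact tsum_congr fun n => by rw [← thetaTerm_ofReal_mul_I]; push_cast; rfl
  rw [this, ofReal_re]

lemma thetaFour_ofReal_mul_I (t : ℝ) :
    ((thetaFour (t * I)).re : ℂ) = thetaFour (t * I) := by
  have : thetaFour (t * I) = ((∑' n : ℤ, (-1 : ℝ) ^ n * rexp (-(π * t * (n : ℝ) ^ 2)) : ℝ) : ℂ) := by
    rw [Complex.ofReal_tsum]
    exact tsum_congr fun n => by
      rw [Complex.ofReal_mul, ← thetaTerm_ofReal_mul_I]; push_cast; rfl
  rw [this, ofReal_re]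

/-- The restriction of `λ` to the imaginary axis. -/
def lambdaReal (t : ℝ) : ℝ := 1 - (thetaFour (t * I)).re ^ 4 / (thetaThree (t * I)).re ^ 4

lemma ofReal_lambdaReal (t : ℝ) : (lambdaReal t : ℂ) = lambdaFun (t * I) := by
  rw [lambdaReal, lambdaFun]
  push_cast
  rw [thetaThree_ofReal_mul_I, thetaFour_ofReal_mul_I]

lemma thetaThree_re_ne_zero {t : ℝ} (ht : 0 < t) : (thetaThree (t * I)).re ≠ 0 := by
  rw [← Complex.ofReal_ne_zero, thetaThree_ofReal_mul_I]
  exact thetaThree_ne_zero (by simpa using ht)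

lemma thetaFour_re_ne_zero {t : ℝ} (ht : 0 < t) : (thetaFour (t * I)).re ≠ 0 := by
  rw [← Complex.ofReal_ne_zero, thetaFour_ofReal_mul_I]
  exact thetaFour_ne_zero (by simpa using ht)

lemma ellipticI_theta_two_mul {t : ℝ} (ht : 0 < t) :
    ellipticI ((thetaThree (2 * (t * I))).re ^ 2) ((thetaFour (2 * (t * I))).re ^ 2) =
      ellipticI ((thetaThree (t * I)).re ^ 2) ((thetaFour (t * I)).re ^ 2) := by
  have h3 := thetaThree_re_ne_zero ht
  have h4 := thetaFour_re_ne_zero ht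
  have him : 0 < ((t : ℂ) * I).im := by simpa using ht
  have e : 2 * ((t : ℂ) * I) = ((2 * t : ℝ) : ℂ) * I := by push_cast; ring
  have h1 : ((thetaThree (t * I)).re ^ 2 + (thetaFour (t * I)).re ^ 2) / 2 =
      (thetaThree (2 * (t * I))).re ^ 2 := by
    have := thetaThree_sq_add_thetaFour_sq him
    have : (thetaThree (t * I)).re ^ 2 + (thetaFour (t * I)).re ^ 2 =
        2 * (thetaThree (2 * (t * I))).re ^ 2 := by
      rw [← Complex.ofReal_inj]
      push_cast
      rw [thetaThree_ofReal_mul_I, thetaFour_ofReal_mul_I, this, e, thetaThree_ofReal_mul_I]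
    linarith
  have h2 : √((thetaThree (t * I)).re ^ 2 * (thetaFour (t * I)).re ^ 2) =
      (thetaFour (2 * (t * I))).re ^ 2 := by
    have := thetaThree_mul_thetaFour him
    have : (thetaThree (t * I)).re * (thetaFour (t * I)).re =
        (thetaFour (2 * (t * I))).re ^ 2 := by
      rw [← Complex.ofReal_inj]
      push_cast
      rw [thetaThree_ofReal_mul_I, thetaFour_ofReal_mul_I, this, e, thetaFour_ofReal_mul_I]
    -- The product θ₃θ₄ is a real square, so its absolute value can be dropped without knowing
    -- either sign.
    rw [← mul_pow, Real.sqrt_sq_eq_abs, this, abs_of_nonneg (by positivity)]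
  rw [← ellipticI_gauss (a := (thetaThree (t * I)).re ^ 2) (by positivity) (by positivity), h1, h2]

/-- Doubling leaves the integral unchanged while both arguments tend to 1. -/
lemma ellipticI_theta {t : ℝ} (ht : 0 < t) :
    ellipticI ((thetaThree (t * I)).re ^ 2) ((thetaFour (t * I)).re ^ 2) = π / 2 := by
  have him : 0 < ((t : ℂ) * I).im := by simpa using ht
  have e : ∀ n : ℕ, (2 : ℂ) ^ n * ((t : ℂ) * I) = ((2 ^ n * t : ℝ) : ℂ) * I := fun n => by
    push_cast; ring
  have hc : ∀ n : ℕ, ellipticI ((thetaThree (2 ^ n * (t * I))).re ^ 2)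
      ((thetaFour (2 ^ n * (t * I))).re ^ 2) =
      ellipticI ((thetaThree (t * I)).re ^ 2) ((thetaFour (t * I)).re ^ 2) := by
    intro n
    induction n with
    | zero => simp
    | succ n ih => rw [← ih, pow_succ' (2 : ℂ) n, mul_assoc, e, ellipticI_theta_two_mul (by positivity)]
  have hlim : ∀ {θ : ℂ → ℂ}, Tendsto θ (comap im atTop) (𝓝 1) →
      Tendsto (fun n : ℕ => (θ (2 ^ n * (t * I))).re ^ 2) atTop (𝓝 1) := by
    intro θ hθ
    have := ((continuous_re.tendsto _).comp (hθ.comp (tendsto_two_pow_mul him))).pow 2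
    simpa using! this
  have h3 : ∀ n : ℕ, 0 < (thetaThree (2 ^ n * (t * I))).re ^ 2 := fun n => by
    have : (thetaThree (2 ^ n * (t * I))).re ≠ 0 := e n ▸ thetaThree_re_ne_zero (by positivity)
    positivity
  have h4 : ∀ n : ℕ, 0 < (thetaFour (2 ^ n * (t * I))).re ^ 2 := fun n => by
    have : (thetaFour (2 ^ n * (t * I))).re ≠ 0 := e n ▸ thetaFour_re_ne_zero (by positivity)
    positivity
  have := tendsto_ellipticI h3 h4 (hlim tendsto_thetaThree) (hlim tendsto_thetaFour)
  simp only [hc] at this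
  exact tendsto_nhds_unique tendsto_const_nhds this

lemma lambdaReal_lt_one {t : ℝ} (ht : 0 < t) : lambdaReal t < 1 := by
  have h3 := thetaThree_re_ne_zero ht
  have h4 := thetaFour_re_ne_zero ht
  have : 0 < (thetaFour (t * I)).re ^ 4 / (thetaThree (t * I)).re ^ 4 := by positivity
  rw [lambdaReal]; linarith

lemma neg_one_div_ofReal_mul_I (t : ℝ) : -1 / ((t : ℂ) * I) = ((t⁻¹ : ℝ) : ℂ) * I := by
  rw [← div_div, div_I, ofReal_inv]; ring

lemma lambdaReal_inv {t : ℝ} (ht : 0 < t) : lambdaReal t⁻¹ = 1 - lambdaReal t := by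
  rw [← Complex.ofReal_inj, ofReal_lambdaReal, ← neg_one_div_ofReal_mul_I,
    lambdaFun_neg_one_div (by simpa using ht), ← ofReal_lambdaReal]
  simp

lemma lambdaReal_pos {t : ℝ} (ht : 0 < t) : 0 < lambdaReal t := by
  have := lambdaReal_lt_one (inv_pos.2 ht)
  rw [lambdaReal_inv ht] at this
  linarith

lemma period₀_lambdaReal {t : ℝ} (ht : 0 < t) :
    period₀ (lambdaReal t) = thetaThree (t * I) ^ 2 := by
  have h3 := thetaThree_re_ne_zero ht
  have : √(1 - lambdaReal t) = (thetaFour (t * I)).re ^ 2 / (thetaThree (t * I)).re ^ 2 := by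
    rw [← Real.sqrt_sq (show 0 ≤ (thetaFour (t * I)).re ^ 2 / (thetaThree (t * I)).re ^ 2 by
      positivity), lambdaReal]
    congr 1
    ring
  rw [period₀_ofReal (lambdaReal_lt_one ht), this, ellipticI_eq_mul (by positivity),
    ellipticI_theta ht, ← thetaThree_ofReal_mul_I, ← ofReal_pow, ofReal_inj, ofReal_re]
  field_simp

/-- Here ϖ₁(λ(it)) = i ϖ₀(λ(i/t)) = i θ₃(i/t)², and the inversion formula turns θ₃(i/t)² into t
θ₃(it)². -/
lemma period₁_lambdaReal {t : ℝ} (ht : 0 < t) :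
    period₁ (lambdaReal t) = t * I * thetaThree (t * I) ^ 2 := by
  rw [period₁_eq (lambdaReal_pos ht) (lambdaReal_lt_one ht), ← lambdaReal_inv ht,
    period₀_lambdaReal (inv_pos.2 ht), ← neg_one_div_ofReal_mul_I,
    thetaThree_neg_one_div (by simpa using ht), mul_pow, neg_I_mul_cpow_half_sq]
  linear_combination (-I * t * thetaThree (t * I) ^ 2) * I_mul_I

lemma period_ratio_lambdaReal {t : ℝ} (ht : 0 < t) :
    period₁ (lambdaReal t) / period₀ (lambdaReal t) = t * I := by
  rw [period₁_lambdaReal ht, period₀_lambdaReal ht]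
  have := thetaThree_ne_zero (τ := t * I) (by simpa using ht)
  field_simp

lemma continuousOn_lambdaReal : ContinuousOn lambdaReal (Ioi 0) := by
  intro t ht
  have h : ContinuousAt lambdaFun ((t : ℂ) * I) :=
    (differentiableAt_lambdaFun (by simpa using ht)).continuousAt
  have h2 : ContinuousAt (fun t : ℝ => lambdaFun (t * I)) t :=
    ContinuousAt.comp (f := fun t : ℝ => (t : ℂ) * I) h (by fun_prop)
  have : lambdaReal = fun t : ℝ => (lambdaFun (t * I)).re :=
    funext fun t => by rw [← ofReal_lambdaReal, ofReal_re]
  rw [this]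
  exact (continuous_re.continuousAt.comp h2).continuousWithinAt

lemma tendsto_lambdaReal : Tendsto lambdaReal atTop (𝓝 0) := by
  have h1 : Tendsto (fun t : ℝ => (t : ℂ) * I) atTop (comap im atTop) := by
    refine tendsto_comap_iff.2 ?_
    simpa [Function.comp_def] using! tendsto_id
  have := (continuous_re.tendsto _).comp (tendsto_lambdaFun.comp h1)
  have e : lambdaReal = fun t : ℝ => (lambdaFun (t * I)).re :=
    funext fun t => by rw [← ofReal_lambdaReal, ofReal_re]
  rw [e]
  simpa using! this

lemma exists_lambdaReal_eq {s : ℝ} (hs : s ∈ Ioo (0 : ℝ) 1) : ∃ t > 0, lambdaReal t = s := by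
  obtain ⟨t₁, h₁, h₁'⟩ :=
    ((tendsto_lambdaReal.eventually_lt_const hs.1).and (eventually_gt_atTop 0)).exists
  -- By λ(i/t) = 1 - λ(it), the point 1/t₂ has λ-value above s.
  obtain ⟨t₂, h₂, h₂'⟩ :=
    ((tendsto_lambdaReal.eventually_lt_const (sub_pos.2 hs.2)).and (eventually_gt_atTop 0)).exists
  have h3 := lambdaReal_inv h₂'
  obtain ⟨t, ht, rfl⟩ := isPreconnected_Ioi.intermediate_value (mem_Ioi.2 h₁')
    (mem_Ioi.2 (inv_pos.2 h₂')) continuousOn_lambdaReal ⟨h₁.le, by linarith⟩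
  exact ⟨t, ht, rfl⟩

/-! ### The hypergeometric series -/

/-- The coefficients `(1/2)_n / n!` of `(1 - z) ^ (-1/2)`. -/
def halfCoeff : ℕ → ℝ
  | 0 => 1
  | n + 1 => halfCoeff n * ((n + 1 / 2) / (n + 1))

lemma halfCoeff_pos (n : ℕ) : 0 < halfCoeff n := by
  induction n with
  | zero => simp [halfCoeff]
  | succ n ih => rw [halfCoeff]; positivity

lemma halfCoeff_le_one (n : ℕ) : halfCoeff n ≤ 1 := by
  induction n with
  | zero => simp [halfCoeff]
  | succ n ih =>
    rw [halfCoeff]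
    refine mul_le_one₀ ih (by positivity) ?_
    rw [div_le_one (by positivity)]
    linarith

lemma ascPochhammer_half_eval (n : ℕ) :
    (ascPochhammer ℂ n).eval (1 / 2 : ℂ) = (n.factorial : ℂ) * halfCoeff n := by
  induction n with
  | zero => simp [halfCoeff]
  | succ n ih =>
    rw [ascPochhammer_succ_eval, ih, halfCoeff, Nat.factorial_succ]
    have : (n : ℂ) + 1 ≠ 0 := by exact_mod_cast n.succ_ne_zero
    push_cast
    field_simp
    ring

lemma ordinaryHypergeometric_half_eq_tsum (s : ℂ) :
    ordinaryHypergeometric (1 / 2 : ℂ) (1 / 2 : ℂ) (1 : ℂ) s =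
      ∑' n : ℕ, ((halfCoeff n ^ 2 : ℝ) : ℂ) * s ^ n := by
  rw [ordinaryHypergeometric_eq_tsum]
  refine tsum_congr fun n => ?_
  have : (n.factorial : ℂ) ≠ 0 := by exact_mod_cast n.factorial_ne_zero
  rw [ascPochhammer_half_eval, ascPochhammer_eval_one, smul_eq_mul]
  push_cast
  field_simp

lemma choose_half_eq (n : ℕ) : Ring.choose ((1 / 2 : ℂ) + n - 1) n = halfCoeff n := by
  have h := Ring.factorial_nsmul_multichoose_eq_ascPochhammer (1 / 2 : ℂ) n
  rw [Polynomial.ascPochhammer_smeval_eq_eval, ascPochhammer_half_eval, nsmul_eq_mul] at h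
  have : (n.factorial : ℂ) ≠ 0 := by exact_mod_cast n.factorial_ne_zero
  rw [Ring.choose, show (1 / 2 : ℂ) + n - 1 - n + 1 = 1 / 2 by ring]
  exact mul_left_cancel₀ this h

lemma hasSum_one_div_one_sub_cpow_half {z : ℂ} (hz : ‖z‖ < 1) :
    HasSum (fun n : ℕ => (halfCoeff n : ℂ) * z ^ n) (1 / (1 - z) ^ (1 / 2 : ℂ)) := by
  have := (Complex.one_div_one_sub_cpow_hasFPowerSeriesOnBall_zero (1 / 2)).hasSum (y := z)
    (by rwa [← ENNReal.ofReal_one, Metric.eball_ofReal, mem_ball_zero_iff])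
  simpa [FormalMultilinearSeries.ofScalars_apply_eq, ← choose_half_eq, mul_comm] using this

lemma ofReal_mul_cpow {r : ℝ} (hr : 0 < r) {w : ℂ} (hw : w ≠ 0) (a : ℂ) :
    ((r : ℂ) * w) ^ a = (r : ℂ) ^ a * w ^ a := by
  have hr' : (r : ℂ) ≠ 0 := by exact_mod_cast hr.ne'
  rw [cpow_def_of_ne_zero (mul_ne_zero hr' hw), cpow_def_of_ne_zero hr', cpow_def_of_ne_zero hw,
    log_ofReal_mul hr hw, ← Complex.exp_add, ofReal_log hr.le]
  congr 1
  ring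

/-- With r = 1 + t² ≥ 1, the root splits as √r (1 - s/r)^(1/2), and the binomial series applies
since |s/r| < 1. -/
lemma hasSum_period₀_integrand {s : ℂ} (hs : ‖s‖ < 1) (t : ℝ) :
    HasSum (fun n : ℕ => (halfCoeff n : ℂ) * s ^ n * ((((1 + t ^ 2)⁻¹) ^ (n + 1) : ℝ) : ℂ))
      (1 / ((√(1 + t ^ 2) : ℂ) * ((1 + t ^ 2 : ℝ) - s) ^ (1 / 2 : ℂ))) := by
  set r : ℝ := 1 + t ^ 2 with hr
  have hr1 : 1 ≤ r := by rw [hr]; nlinarith [sq_nonneg t]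
  have hr0 : 0 < r := by linarith
  have hrC : (r : ℂ) ≠ 0 := by exact_mod_cast hr0.ne'
  have hz : ‖s / r‖ < 1 := by
    rw [norm_div, Complex.norm_real, Real.norm_of_nonneg hr0.le, div_lt_one hr0]
    linarith
  have hw : 1 - s / r ≠ 0 := by
    intro h
    rw [← sub_eq_zero.1 h, norm_one] at hz
    exact lt_irrefl _ hz
  have h1 : ((r : ℂ) - s) ^ (1 / 2 : ℂ) = (√r : ℂ) * (1 - s / r) ^ (1 / 2 : ℂ) := by
    rw [show (r : ℂ) - s = r * (1 - s / r) by field_simp, ofReal_mul_cpow hr0 hw,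
      Real.sqrt_eq_rpow, Complex.ofReal_cpow hr0.le]
    push_cast
    rfl
  have h2 : (√r : ℂ) * (√r : ℂ) = r := by rw [← ofReal_mul, Real.mul_self_sqrt hr0.le]
  rw [h1, ← mul_assoc, h2, ← div_div, div_eq_mul_one_div]
  convert! (hasSum_one_div_one_sub_cpow_half hz).mul_left (1 / (r : ℂ)) using 2 with n
  push_cast
  rw [div_pow, inv_pow, pow_succ]
  field_simp

lemma integrable_inv_one_add_sq_pow (n : ℕ) :
    Integrable fun t : ℝ => ((1 + t ^ 2)⁻¹) ^ (n + 1) := by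
  refine integrable_inv_one_add_sq.mono' ?_ (.of_forall fun t => ?_)
  · have : Continuous fun t : ℝ => ((1 + t ^ 2)⁻¹) ^ (n + 1) :=
      (Continuous.inv₀ (by fun_prop) fun t => by positivity).pow _
    exact this.aestronglyMeasurable
  · rw [Real.norm_of_nonneg (by positivity), pow_succ]
    refine mul_le_of_le_one_left (by positivity) (pow_le_one₀ (by positivity) ?_)
    exact inv_le_one_of_one_le₀ (by nlinarith [sq_nonneg t])

lemma integral_inv_one_add_sq_pow (n : ℕ) :
    ∫ t in Ioi (0 : ℝ), ((1 + t ^ 2)⁻¹) ^ (n + 1) = π / 2 * halfCoeff n := by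
  induction n with
  | zero => simp [halfCoeff]
  | succ n ih =>
    have hI := fun k => (integrable_inv_one_add_sq_pow k).integrableOn (s := Ioi 0)
    -- This primitive vanishes at 0 and ∞, giving the recursion (2n + 2) J(n + 1) = (2n + 1) J(n),
    -- the one satisfied by `halfCoeff`.
    have hd : ∀ t ∈ Ici (0 : ℝ), HasDerivAt (fun t : ℝ => t * ((1 + t ^ 2)⁻¹) ^ (n + 1))
        (2 * (n + 1) * ((1 + t ^ 2)⁻¹) ^ (n + 2) - (2 * n + 1) * ((1 + t ^ 2)⁻¹) ^ (n + 1)) t := by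
      intro t _
      have h0 : (1 + t ^ 2 : ℝ) ≠ 0 := by positivity
      have := (hasDerivAt_id t).mul (((((hasDerivAt_pow 2 t).const_add 1).inv h0)).pow (n + 1))
      convert! this using 1
      simp
      field_simp
      ring
    have hlim : Tendsto (fun t : ℝ => t * ((1 + t ^ 2)⁻¹) ^ (n + 1)) atTop (𝓝 0) := by
      refine squeeze_zero' ((eventually_ge_atTop 0).mono fun t ht => by positivity) ?_
        tendsto_inv_atTop_zero
      filter_upwards [eventually_gt_atTop 0] with t ht
      have h1 : ((1 + t ^ 2)⁻¹) ^ n ≤ 1 :=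
        pow_le_one₀ (by positivity) (inv_le_one_of_one_le₀ (by nlinarith [sq_nonneg t]))
      calc t * ((1 + t ^ 2)⁻¹) ^ (n + 1) = (t * (1 + t ^ 2)⁻¹) * ((1 + t ^ 2)⁻¹) ^ n := by ring
        _ ≤ t * (1 + t ^ 2)⁻¹ := mul_le_of_le_one_right (by positivity) h1
        _ ≤ t⁻¹ := by
          rw [← div_eq_mul_inv, div_le_iff₀ (by positivity)]
          field_simp
          linarith
    have key := integral_Ioi_of_hasDerivAt_of_tendsto' hd
      (((hI (n + 1)).const_mul _).sub ((hI n).const_mul _)) hlim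
    rw [integral_sub ((hI (n + 1)).const_mul _) ((hI n).const_mul _), integral_const_mul,
      integral_const_mul, ih, zero_mul, sub_zero] at key
    rw [halfCoeff]
    field_simp at key ⊢
    linarith

lemma hasSum_period₀ {s : ℂ} (hs : ‖s‖ < 1) :
    HasSum (fun n : ℕ => ((halfCoeff n ^ 2 : ℝ) : ℂ) * s ^ n) (period₀ s) := by
  have hg := (hasSum_geometric_of_lt_one (norm_nonneg s) hs)
  have key := hasSum_integral_of_dominated_convergence (μ := volume.restrict (Ioi (0 : ℝ)))
    (F := fun (n : ℕ) (t : ℝ) =>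
      (halfCoeff n : ℂ) * s ^ n * ((((1 + t ^ 2)⁻¹) ^ (n + 1) : ℝ) : ℂ))
    (fun n t => ‖s‖ ^ n * (1 + t ^ 2)⁻¹)
    (fun n => ((integrable_inv_one_add_sq_pow n).ofReal.const_mul _).integrableOn.1)
    (fun n => .of_forall fun t => ?_)
    (.of_forall fun t => (hg.mul_right _).summable) ?_
    (.of_forall fun t => hasSum_period₀_integrand hs t)
  · rw [period₀_eq_integral]
    convert! key.mul_left (2 / π : ℂ) using 2 with n
    rw [integral_const_mul, integral_complex_ofReal, integral_inv_one_add_sq_pow]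
    have : (π : ℂ) ≠ 0 := by exact_mod_cast Real.pi_ne_zero
    push_cast
    field_simp
  · rw [norm_mul, norm_mul, norm_pow, Complex.norm_real, Complex.norm_real,
      Real.norm_of_nonneg (halfCoeff_pos n).le, Real.norm_of_nonneg (by positivity), pow_succ,
      ← mul_assoc]
    have h1 : ((1 + t ^ 2)⁻¹) ^ n ≤ 1 :=
      pow_le_one₀ (by positivity) (inv_le_one_of_one_le₀ (by nlinarith [sq_nonneg t]))
    have h2 : halfCoeff n * ‖s‖ ^ n ≤ ‖s‖ ^ n :=
      mul_le_of_le_one_left (by positivity) (halfCoeff_le_one n)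
    have h3 := (halfCoeff_pos n).le
    refine mul_le_mul_of_nonneg_right ?_ (by positivity)
    exact (mul_le_of_le_one_right (by positivity) h1).trans h2
  · simp only [tsum_mul_right]
    exact (integrable_inv_one_add_sq.const_mul _).integrableOn

lemma period₀_eq_ordinaryHypergeometric {s : ℂ} (hs : ‖s‖ < 1) :
    period₀ s = ordinaryHypergeometric (1 / 2 : ℂ) (1 / 2 : ℂ) (1 : ℂ) s := by
  rw [ordinaryHypergeometric_half_eq_tsum, (hasSum_period₀ hs).tsum_eq]

/-! ### The hypergeometric differential equation -/

lemma summable_mul_pow_sub_one {r : ℝ} (h0 : 0 ≤ r) (h1 : r < 1) :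
    Summable fun n : ℕ => (n : ℝ) * r ^ (n - 1) := by
  rw [← summable_nat_add_iff 1]
  have h := summable_pow_mul_geometric_of_norm_lt_one 1
    (show ‖r‖ < 1 by rwa [Real.norm_of_nonneg h0])
  have := h.add (summable_geometric_of_lt_one h0 h1)
  refine this.congr fun n => ?_
  push_cast
  simp
  ring

lemma norm_mul_pow_sub_one_le {a : ℕ → ℂ} (ha : ∀ n, ‖a n‖ ≤ 1) {z : ℂ} {r : ℝ} (hz : ‖z‖ ≤ r)
    (n : ℕ) : ‖a n * (n * z ^ (n - 1))‖ ≤ n * r ^ (n - 1) := by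
  rw [norm_mul, norm_mul, norm_pow, Complex.norm_natCast]
  calc ‖a n‖ * (n * ‖z‖ ^ (n - 1)) ≤ 1 * (n * ‖z‖ ^ (n - 1)) := by gcongr; exact ha n
    _ ≤ n * r ^ (n - 1) := by rw [one_mul]; gcongr

lemma hasDerivAt_tsum_mul_pow {a : ℕ → ℂ} (ha : ∀ n, ‖a n‖ ≤ 1) {z : ℂ} (hz : ‖z‖ < 1) :
    HasDerivAt (fun z : ℂ => ∑' n, a n * z ^ n) (∑' n : ℕ, a n * (n * z ^ (n - 1))) z := by
  obtain ⟨r, hr, hr1⟩ := exists_between hz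
  have hr0 : 0 < r := (norm_nonneg z).trans_lt hr
  refine hasDerivAt_tsum_of_isPreconnected (t := Metric.ball 0 r) (y₀ := z)
    (summable_mul_pow_sub_one hr0.le hr1) Metric.isOpen_ball
    (convex_ball _ _).isPreconnected (fun n y _ => (hasDerivAt_pow n y).const_mul (a n))
    (fun n y hy => norm_mul_pow_sub_one_le ha ((mem_ball_zero_iff.1 hy).le) n) (by simpa using hr) ?_
    (by simpa using hr)
  refine .of_norm_bounded (summable_geometric_of_lt_one (norm_nonneg z) hz) fun n => ?_
  rw [norm_mul, norm_pow]
  exact mul_le_of_le_one_left (by positivity) (ha n)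

lemma norm_halfCoeff_sq_le (n : ℕ) : ‖((halfCoeff n ^ 2 : ℝ) : ℂ)‖ ≤ 1 := by
  have h := halfCoeff_pos n
  rw [Complex.norm_real, Real.norm_of_nonneg (by positivity)]
  exact pow_le_one₀ h.le (halfCoeff_le_one n)

/-- The function `s (1 - s) ϖ₀'(s)`, as a power series. -/
def quasiDeriv (z : ℂ) : ℂ := ∑' n : ℕ, ((halfCoeff (n - 1) ^ 2 / (4 * n) : ℝ) : ℂ) * z ^ n

lemma norm_quasiDeriv_coeff_le (n : ℕ) : ‖((halfCoeff (n - 1) ^ 2 / (4 * n) : ℝ) : ℂ)‖ ≤ 1 := by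
  -- The constant coefficient is 0, through division by zero.
  rcases n with _ | n
  · simp
  · have h := halfCoeff_pos n
    rw [Complex.norm_real, Real.norm_of_nonneg (by positivity)]
    simp only [add_tsub_cancel_right]
    rw [div_le_one (by positivity)]
    push_cast
    have := pow_le_one₀ h.le (halfCoeff_le_one n) (n := 2)
    have : (0 : ℝ) ≤ n := n.cast_nonneg
    linarith

/-- With `hasDerivAt_period₀`, this is the hypergeometric equation in self-adjoint form, (s(1 -
s)ϖ₀')' = ϖ₀/4. -/
lemma hasDerivAt_quasiDeriv {z : ℂ} (hz : ‖z‖ < 1) :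
    HasDerivAt quasiDeriv (period₀ z / 4) z := by
  refine (hasDerivAt_tsum_mul_pow norm_quasiDeriv_coeff_le hz).congr_deriv ?_
  have hs : Summable fun n : ℕ => ((halfCoeff (n - 1) ^ 2 / (4 * n) : ℝ) : ℂ) *
      (n * z ^ (n - 1)) :=
    .of_norm_bounded (summable_mul_pow_sub_one (norm_nonneg z) hz)
      (norm_mul_pow_sub_one_le norm_quasiDeriv_coeff_le le_rfl)
  rw [hs.tsum_eq_zero_add, ← (hasSum_period₀ hz).tsum_eq, ← tsum_div_const]
  simp only [Nat.cast_zero, zero_mul, mul_zero, zero_add, add_tsub_cancel_right]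
  refine tsum_congr fun n => ?_
  have : (n : ℂ) + 1 ≠ 0 := by exact_mod_cast n.succ_ne_zero
  push_cast
  field_simp

lemma hasDerivAt_period₀ {z : ℂ} (hz : ‖z‖ < 1) (h0 : z ≠ 0) :
    HasDerivAt period₀ (quasiDeriv z / (z * (1 - z))) z := by
  have h1 : 1 - z ≠ 0 := by
    intro h
    rw [← sub_eq_zero.1 h, norm_one] at hz
    exact lt_irrefl _ hz
  have hev : period₀ =ᶠ[𝓝 z] fun z => ∑' n : ℕ, ((halfCoeff n ^ 2 : ℝ) : ℂ) * z ^ n := by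
    filter_upwards [continuous_norm.continuousAt.eventually_lt_const hz] with w hw
    exact (hasSum_period₀ hw).tsum_eq.symm
  refine HasDerivAt.congr_of_eventuallyEq ?_ hev
  refine (hasDerivAt_tsum_mul_pow norm_halfCoeff_sq_le hz).congr_deriv ?_
  rw [eq_div_iff (mul_ne_zero h0 h1)]
  have hs : Summable fun n : ℕ => ((halfCoeff n ^ 2 : ℝ) : ℂ) * (n * z ^ (n - 1)) :=
    .of_norm_bounded (summable_mul_pow_sub_one (norm_nonneg z) hz)
      (norm_mul_pow_sub_one_le norm_halfCoeff_sq_le le_rfl)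
  have hq : Summable fun n : ℕ => ((halfCoeff (n - 1) ^ 2 / (4 * n) : ℝ) : ℂ) * z ^ n := by
    refine .of_norm_bounded (summable_geometric_of_lt_one (norm_nonneg z) hz) fun n => ?_
    rw [norm_mul, norm_pow]
    exact mul_le_of_le_one_left (by positivity) (norm_quasiDeriv_coeff_le n)
  have e1 : (∑' n : ℕ, ((halfCoeff n ^ 2 : ℝ) : ℂ) * (n * z ^ (n - 1))) * z =
      ∑' n : ℕ, ((halfCoeff n ^ 2 : ℝ) : ℂ) * n * z ^ n := by
    rw [← tsum_mul_right]
    refine tsum_congr fun n => ?_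
    rcases n with _ | n
    · simp
    · rw [add_tsub_cancel_right, pow_succ]; ring
  have hs1 : Summable fun n : ℕ => ((halfCoeff n ^ 2 : ℝ) : ℂ) * n * z ^ n := by
    refine (hs.mul_right z).congr fun n => ?_
    rcases n with _ | n
    · simp
    · rw [add_tsub_cancel_right, pow_succ]; ring
  rw [← mul_assoc, e1, mul_sub, mul_one]
  nth_rw 1 [hs1.tsum_eq_zero_add]
  rw [← tsum_mul_right, quasiDeriv, hq.tsum_eq_zero_add]
  simp only [Nat.cast_zero, mul_zero, zero_mul, zero_add, add_tsub_cancel_right, div_zero,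
    ofReal_zero]
  rw [← ((summable_nat_add_iff 1).2 hs1).tsum_sub (hs1.mul_right z)]
  -- With c = `halfCoeff`, the recursion gives (n + 1)c(n + 1)² - n c(n)² = c(n)²/(4(n + 1)).
  refine tsum_congr fun n => ?_
  have : (n : ℂ) + 1 ≠ 0 := by exact_mod_cast n.succ_ne_zero
  rw [halfCoeff]
  push_cast
  field_simp
  ring

lemma differentiableAt_period₀ {z : ℂ} (hz : ‖z‖ < 1) : DifferentiableAt ℂ period₀ z := by
  have hev : period₀ =ᶠ[𝓝 z] fun z => ∑' n : ℕ, ((halfCoeff n ^ 2 : ℝ) : ℂ) * z ^ n := by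
    filter_upwards [continuous_norm.continuousAt.eventually_lt_const hz] with w hw
    exact (hasSum_period₀ hw).tsum_eq.symm
  exact ((hasDerivAt_tsum_mul_pow norm_halfCoeff_sq_le hz).congr_of_eventuallyEq
    hev).differentiableAt

/-- The Wronskian of `ϖ₀(z)` and `ϖ₀(1 - z)`, multiplied by `-z (1 - z)`. -/
def wronskian (z : ℂ) : ℂ := period₀ z * quasiDeriv (1 - z) + quasiDeriv z * period₀ (1 - z)

/-- The self-adjoint equation is symmetric under z ↦ 1 - z, so the four terms cancel in pairs. -/
lemma hasDerivAt_wronskian {z : ℂ} (hz : ‖z‖ < 1) (hz' : ‖1 - z‖ < 1) (h0 : z ≠ 0)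
    (h1 : 1 - z ≠ 0) : HasDerivAt wronskian 0 z := by
  have hid : HasDerivAt (fun z : ℂ => 1 - z) (-1) z := by
    simpa using (hasDerivAt_id z).const_sub 1
  have hP := hasDerivAt_period₀ hz h0
  have hQ := hasDerivAt_quasiDeriv hz
  have hP' := (hasDerivAt_period₀ hz' h1).comp z hid
  have hQ' := (hasDerivAt_quasiDeriv hz').comp z hid
  convert! (hP.mul hQ').add (hQ.mul hP') using 1
  simp only [Function.comp_apply, sub_sub_cancel]
  field_simp
  ring

lemma exists_wronskian_eq : ∃ c, ∀ s ∈ Ioo (0 : ℝ) 1, wronskian s = c := by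
  have hz : ∀ z ∈ Metric.ball (0 : ℂ) 1 ∩ Metric.ball 1 1, HasDerivAt wronskian 0 z := by
    intro z hz
    have h1 : ‖z‖ < 1 := by simpa using hz.1
    have h2 : ‖1 - z‖ < 1 := by simpa [dist_eq_norm, norm_sub_rev] using hz.2
    refine hasDerivAt_wronskian h1 h2 ?_ ?_
    · rintro rfl; simp at h2
    · intro h; rw [← sub_eq_zero.1 h] at h1; simp at h1
  obtain ⟨c, hc⟩ := (Metric.isOpen_ball.inter Metric.isOpen_ball).exists_is_const_of_deriv_eq_zero
    ((convex_ball (0 : ℂ) 1).inter (convex_ball 1 1)).isPreconnected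
    (fun z h => (hz z h).differentiableAt.differentiableWithinAt) (fun z h => (hz z h).deriv)
  refine ⟨c, fun s hs => hc s ⟨?_, ?_⟩⟩
  · rw [mem_ball_zero_iff, Complex.norm_real, Real.norm_of_nonneg hs.1.le]
    exact hs.2
  · rw [Metric.mem_ball, dist_eq_norm, ← ofReal_one, ← ofReal_sub, Complex.norm_real,
      Real.norm_eq_abs, abs_lt]
    constructor <;> linarith [hs.1, hs.2]

/-! ### The derivative of `λ` does not vanish -/

/-- Holomorphic functions on a half plane `c < im τ` that agree far up on the imaginary axis are
equal. -/
lemma eqOn_of_eventually_imaginary_axis {f g : ℂ → ℂ} {c : ℝ}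
    (hf : DifferentiableOn ℂ f {z | c < z.im}) (hg : DifferentiableOn ℂ g {z | c < z.im})
    (h : ∀ᶠ t : ℝ in atTop, f (t * I) = g (t * I)) : EqOn f g {z | c < z.im} := by
  have hopen : IsOpen {z : ℂ | c < z.im} := isOpen_lt continuous_const continuous_im
  obtain ⟨a, ha⟩ := eventually_atTop.1 h
  set t₀ : ℝ := max a c + 1
  have h1 : a < t₀ := (le_max_left a c).trans_lt (lt_add_one _)
  have h2 : c < t₀ := (le_max_right a c).trans_lt (lt_add_one _)
  refine (hf.analyticOnNhd hopen).eqOn_of_preconnected_of_frequently_eq (hg.analyticOnNhd hopen)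
    (convex_halfSpace_im_gt c).isPreconnected (z₀ := t₀ * I) (by simpa using h2) ?_
  have ht : Tendsto (fun t : ℝ => (t : ℂ) * I) (𝓝[≠] t₀) (𝓝[≠] (t₀ * I)) := by
    refine tendsto_nhdsWithin_of_tendsto_nhds_of_eventually_within _ ?_ ?_
    · exact tendsto_nhdsWithin_of_tendsto_nhds
        (Continuous.tendsto (by fun_prop : Continuous fun t : ℝ => (t : ℂ) * I) t₀)
    · filter_upwards [self_mem_nhdsWithin] with t ht h
      exact ht (by simpa using h)
  refine ht.frequently (Eventually.frequently ?_)
  filter_upwards [mem_nhdsWithin_of_mem_nhds (lt_mem_nhds h1)] with t ht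
  exact ha t ht.le

lemma lambdaFun_I_mul_ratio {s : ℝ} (hs : s ∈ Ioo (0 : ℝ) 1) :
    lambdaFun (I * (period₀ (1 - s) / period₀ s)) = s := by
  obtain ⟨t, ht, rfl⟩ := exists_lambdaReal_eq hs
  have h := period_ratio_lambdaReal ht
  rw [period₁_eq hs.1 hs.2, ofReal_sub, ofReal_one, mul_div_assoc] at h
  rw [h, ofReal_lambdaReal]

/-- Differentiate λ(ρ(s)) = s for ρ(s) = i ϖ₀(1 - s)/ϖ₀(s). With C the constant value of
`wronskian`, ρ' = -iC/(s(1 - s)ϖ₀²), and ϖ₀² = θ₃⁴. -/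
lemma exists_deriv_lambdaFun_imaginary_axis : ∃ c : ℂ, ∀ t : ℝ, 0 < t →
    deriv lambdaFun (t * I) * c =
      lambdaFun (t * I) * (1 - lambdaFun (t * I)) * thetaThree (t * I) ^ 4 := by
  obtain ⟨c, hc⟩ := exists_wronskian_eq
  refine ⟨-(I * c), fun t ht => ?_⟩
  have him : 0 < ((t : ℂ) * I).im := by simpa using ht
  set s := lambdaReal t with hs
  have hs01 : s ∈ Ioo (0 : ℝ) 1 := ⟨lambdaReal_pos ht, lambdaReal_lt_one ht⟩
  have hF : period₀ s = thetaThree (t * I) ^ 2 := period₀_lambdaReal ht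
  have hF0 : period₀ s ≠ 0 := period₀_ofReal_ne_zero hs01.2
  have hs0 : (s : ℂ) ≠ 0 := by exact_mod_cast hs01.1.ne'
  have hs1 : (1 - s : ℂ) ≠ 0 := by exact_mod_cast (sub_pos.2 hs01.2).ne'
  have hn0 : ‖(s : ℂ)‖ < 1 := by
    rw [Complex.norm_real, Real.norm_of_nonneg hs01.1.le]; exact hs01.2
  have hn1 : ‖(1 - s : ℂ)‖ < 1 := by
    rw [← ofReal_one, ← ofReal_sub, Complex.norm_real,
      Real.norm_of_nonneg (sub_pos.2 hs01.2).le]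
    linarith [hs01.1]
  have hρ : I * (period₀ (1 - s) / period₀ s) = t * I := by
    rw [← period_ratio_lambdaReal ht, ← hs, period₁_eq hs01.1 hs01.2, ofReal_sub, ofReal_one,
      mul_div_assoc]
  have hid : HasDerivAt (fun z : ℂ => 1 - z) (-1) (s : ℂ) := by
    simpa using (hasDerivAt_id (s : ℂ)).const_sub 1
  have hd1 := ((hasDerivAt_period₀ hn1 hs1).comp (s : ℂ) hid).div (hasDerivAt_period₀ hn0 hs0) hF0
  have hd2 := hd1.const_mul I
  have hlam : HasDerivAt lambdaFun (deriv lambdaFun (t * I))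
      (I * (period₀ (1 - s) / period₀ s)) := by
    rw [hρ]
    exact (differentiableAt_lambdaFun him).hasDerivAt
  -- The identity λ(ρ(s)) = s is available only for real s, so derivatives are compared along ℝ.
  have hd3 := (hlam.comp (s : ℂ) hd2).comp_ofReal
  have hd4 : HasDerivAt (fun x : ℝ => (x : ℂ)) 1 s := by
    simpa using (hasDerivAt_id (s : ℂ)).comp_ofReal
  have hev : (fun x : ℝ => (x : ℂ)) =ᶠ[𝓝 s]
      fun x : ℝ => lambdaFun (I * (period₀ (1 - x) / period₀ x)) := by
    filter_upwards [Ioo_mem_nhds hs01.1 hs01.2] with x hx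
    exact (lambdaFun_I_mul_ratio hx).symm
  have key := hd3.unique (hd4.congr_of_eventuallyEq hev.symm)
  simp only [Function.comp_apply, sub_sub_cancel] at key
  have hcs := hc s hs01
  rw [wronskian] at hcs
  rw [← ofReal_lambdaReal, ← hs, show thetaThree (t * I) ^ 4 = period₀ s ^ 2 by rw [hF]; ring,
    ← hcs]
  field_simp at key
  linear_combination key

lemma isOpen_im_pos : IsOpen {z : ℂ | 0 < z.im} := isOpen_lt continuous_const continuous_im

/-- The relation on the axis extends to the half plane, and its right side has no zeros. The
constant need not be evaluated. -/
lemma deriv_lambdaFun_ne_zero {τ : ℂ} (hτ : 0 < τ.im) : deriv lambdaFun τ ≠ 0 := by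
  obtain ⟨c, hc⟩ := exists_deriv_lambdaFun_imaginary_axis
  have hlam : DifferentiableOn ℂ lambdaFun {z | 0 < z.im} := fun z hz =>
    (differentiableAt_lambdaFun hz).differentiableWithinAt
  have hth : DifferentiableOn ℂ thetaThree {z | 0 < z.im} := fun z hz =>
    (differentiableAt_thetaThree hz).differentiableWithinAt
  have := eqOn_of_eventually_imaginary_axis (f := fun z => deriv lambdaFun z * c)
    (g := fun z => lambdaFun z * (1 - lambdaFun z) * thetaThree z ^ 4)
    ((hlam.deriv isOpen_im_pos).mul_const c)
    ((hlam.mul (hlam.const_sub 1)).mul (hth.pow 4))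
    ((eventually_gt_atTop 0).mono fun t ht => hc t ht) hτ
  intro h
  simp only [h, zero_mul] at this
  exact mul_ne_zero (mul_ne_zero (lambdaFun_ne_zero hτ) (one_sub_lambdaFun_ne_zero hτ))
    (pow_ne_zero 4 (thetaThree_ne_zero hτ)) this.symm

/-! ### Existence and uniqueness -/

lemma mdifferentiable_comp_coe {f : ℂ → ℂ} (hf : ∀ τ : ℂ, 0 < τ.im → DifferentiableAt ℂ f τ) :
    MDifferentiable 𝓘(ℂ) 𝓘(ℂ) fun τ : ℍ => f τ :=
  fun τ => (hf τ τ.im_pos).mdifferentiableAt.comp τ τ.mdifferentiable_coe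

lemma eq_of_eventually_imaginary_axis {f : ℍ → ℂ} {g : ℂ → ℂ}
    (hf : MDifferentiable 𝓘(ℂ) 𝓘(ℂ) f) (hg : ∀ τ : ℂ, 0 < τ.im → DifferentiableAt ℂ g τ)
    (h : ∀ᶠ t : ℝ in atTop, ∀ τ : ℍ, (τ : ℂ) = t * I → f τ = g (t * I)) (τ : ℍ) : f τ = g τ := by
  have := eqOn_of_eventually_imaginary_axis (UpperHalfPlane.mdifferentiable_iff.1 hf)
    (fun z hz => (hg z hz).differentiableWithinAt) ?_ τ.im_pos
  · simpa using this
  · filter_upwards [h, eventually_gt_atTop 0] with t ht ht0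
    have him : 0 < ((t : ℂ) * I).im := by simpa using ht0
    rw [Function.comp_apply, UpperHalfPlane.ofComplex_apply_of_im_pos him]
    exact ht ⟨t * I, him⟩ rfl

lemma isModularLambda_lambdaFun : IsModularLambda fun τ : ℍ => lambdaFun τ where
  holomorphic := mdifferentiable_comp_coe fun _ => differentiableAt_lambdaFun
  ne_zero τ := lambdaFun_ne_zero τ.im_pos
  ne_one τ h := one_sub_lambdaFun_ne_zero τ.im_pos (sub_eq_zero.2 h.symm)
  inverts s hs := by
    obtain ⟨t, ht, rfl⟩ := exists_lambdaReal_eq hs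
    refine ⟨⟨t * I, by simpa using ht⟩, ?_, ?_⟩
    · rw [period_ratio_lambdaReal ht]
    · rw [ofReal_lambdaReal]

lemma IsModularLambda.eq_lambdaFun {lam : ℍ → ℂ} (h : IsModularLambda lam) :
    lam = fun τ : ℍ => lambdaFun τ := by
  ext τ
  refine eq_of_eventually_imaginary_axis h.holomorphic
    (fun _ => differentiableAt_lambdaFun) ?_ τ
  filter_upwards [eventually_gt_atTop 0] with t ht τ hτ
  -- The point supplied for s = λ(it) has coordinate equal to the period ratio, which is it.
  obtain ⟨τ', h1, h2⟩ := h.inverts (lambdaReal t) ⟨lambdaReal_pos ht, lambdaReal_lt_one ht⟩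
  rw [period_ratio_lambdaReal ht, ← hτ] at h1
  rw [UpperHalfPlane.ext h1, ofReal_lambdaReal] at h2
  exact h2

lemma eventually_period₀_lambdaFun : ∀ᶠ τ : ℍ in UpperHalfPlane.atImInfty,
    ‖lambdaFun τ‖ < 1 ∧ thetaThree τ ^ 2 = period₀ (lambdaFun τ) := by
  have h : ∀ᶠ τ : ℂ in comap im atTop, ‖lambdaFun τ‖ < 1 :=
    tendsto_lambdaFun.norm.eventually_lt_const (by simp)
  rw [eventually_comap, eventually_atTop] at h
  obtain ⟨a, ha⟩ := h
  have hpos : ∀ z : ℂ, max a 0 < z.im → 0 < z.im := fun z hz => (le_max_right a 0).trans_lt hz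
  have hlt : ∀ z : ℂ, max a 0 < z.im → ‖lambdaFun z‖ < 1 := fun z hz =>
    ha z.im ((le_max_left a 0).trans hz.le) z rfl
  have key : EqOn (fun z => thetaThree z ^ 2) (fun z => period₀ (lambdaFun z))
      {z | max a 0 < z.im} := by
    refine eqOn_of_eventually_imaginary_axis
      (fun z hz => ((differentiableAt_thetaThree (hpos z hz)).pow 2).differentiableWithinAt)
      (fun z hz => ((differentiableAt_period₀ (hlt z hz)).comp z
        (differentiableAt_lambdaFun (hpos z hz))).differentiableWithinAt) ?_
    filter_upwards [eventually_gt_atTop 0] with t ht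
    rw [← ofReal_lambdaReal, period₀_lambdaReal ht]
  rw [Filter.Eventually, UpperHalfPlane.atImInfty_mem]
  -- The 1 passes from the closed condition at the cusp to the open half plane of `key`.
  refine ⟨max a 0 + 1, fun τ hτ => ?_⟩
  have hτ' : max a 0 < (τ : ℂ).im := (lt_add_one _).trans_le hτ
  exact ⟨hlt τ hτ', key hτ'⟩

lemma isPeriodAlong_theta₃_sq :
    IsPeriodAlong (fun τ : ℍ => lambdaFun τ) fun τ => thetaThree τ ^ 2 where
  holomorphic := mdifferentiable_comp_coe (f := fun z => thetaThree z ^ 2) fun _ h =>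
    (differentiableAt_thetaThree h).pow 2
  near_cusp := eventually_period₀_lambdaFun
  branch τ₀ := by
    have hlam : DifferentiableOn ℂ lambdaFun {z | 0 < z.im} := fun z hz =>
      (differentiableAt_lambdaFun hz).differentiableWithinAt
    have hth : DifferentiableOn ℂ thetaThree {z | 0 < z.im} := fun z hz =>
      (differentiableAt_thetaThree hz).differentiableWithinAt
    have ha : AnalyticAt ℂ lambdaFun τ₀ :=
      hlam.analyticAt (isOpen_im_pos.mem_nhds τ₀.im_pos)
    have hd := deriv_lambdaFun_ne_zero τ₀.im_pos
    have hinv := ha.analyticAt_localInverse hd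
    have happ : ha.hasStrictDerivAt.localInverse _ _ _ hd (lambdaFun τ₀) = τ₀ :=
      HasStrictFDerivAt.localInverse_apply_image ..
    -- The branch is θ₃² composed with a local inverse of λ, which exists because λ' ≠ 0.
    refine ⟨fun z => thetaThree (ha.hasStrictDerivAt.localInverse _ _ _ hd z) ^ 2, ?_, ?_⟩
    · refine AnalyticAt.pow (AnalyticAt.fun_comp ?_ hinv) 2
      rw [happ]
      exact hth.analyticAt (isOpen_im_pos.mem_nhds τ₀.im_pos)
    · have := UpperHalfPlane.continuous_coe.continuousAt.eventually
        (ha.hasStrictDerivAt.eventually_left_inverse hd)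
      filter_upwards [this] with τ hτ
      rw [hτ]

/-- The condition at the cusp fixes W high on the imaginary axis; the identity theorem does the
rest. -/
lemma IsPeriodAlong.eq_theta₃_sq {W : ℍ → ℂ}
    (h : IsPeriodAlong (fun τ : ℍ => lambdaFun τ) W) : W = fun τ : ℍ => thetaThree τ ^ 2 := by
  ext τ
  refine eq_of_eventually_imaginary_axis (g := fun z => thetaThree z ^ 2) h.holomorphic
    (fun _ h => (differentiableAt_thetaThree h).pow 2) ?_ τ
  have h1 := h.near_cusp
  rw [Filter.Eventually, UpperHalfPlane.atImInfty_mem] at h1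
  obtain ⟨a, ha⟩ := h1
  filter_upwards [eventually_ge_atTop a, eventually_gt_atTop 0] with t ht ht0 τ hτ
  have him : a ≤ τ.im := by
    rw [← UpperHalfPlane.coe_im, hτ, im_ofReal_mul_I]
    exact ht
  rw [(ha τ him).2, hτ, ← ofReal_lambdaReal, period₀_lambdaReal ht0]

end LegendreFamily

end

theorem mainTheorem6 :
    (∀ s : ℂ, ‖s‖ < 1 →
      LegendreFamily.period₀ s = ordinaryHypergeometric (1 / 2 : ℂ) (1 / 2 : ℂ) (1 : ℂ) s) ∧
    (∃! lam : ℍ → ℂ, LegendreFamily.IsModularLambda lam) ∧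
    ∀ lam : ℍ → ℂ, LegendreFamily.IsModularLambda lam →
      (∃! W : ℍ → ℂ, LegendreFamily.IsPeriodAlong lam W) ∧
      ∀ W : ℍ → ℂ, LegendreFamily.IsPeriodAlong lam W → ∀ τ : ℍ,
        W τ = LegendreFamily.theta₃ τ ^ 2 ∧
        LegendreFamily.theta₂ τ ^ 4 = lam τ * W τ ^ 2 ∧
        LegendreFamily.theta₄ τ ^ 4 = (1 - lam τ) * W τ ^ 2 := by
  refine ⟨fun s hs => LegendreFamily.period₀_eq_ordinaryHypergeometric hs,
    ⟨_, LegendreFamily.isModularLambda_lambdaFun, fun lam h => h.eq_lambdaFun⟩, fun lam hlam => ?_⟩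
  obtain rfl := hlam.eq_lambdaFun
  refine ⟨⟨_, LegendreFamily.isPeriodAlong_theta₃_sq, fun W h => h.eq_theta₃_sq⟩,
    fun W hW τ => ?_⟩
  obtain rfl := hW.eq_theta₃_sq
  have h3 := LegendreFamily.thetaThree_ne_zero τ.im_pos
  beta_reduce
  refine ⟨by rw [LegendreFamily.theta₃_eq], ?_, ?_⟩
  · rw [LegendreFamily.theta₂_eq, LegendreFamily.lambdaFun_eq τ.im_pos]
    field_simp
  · rw [LegendreFamily.theta₄_eq, LegendreFamily.one_sub_lambdaFun]
    field_simp
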